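/- Let $(M,g)$ be a non-empty smooth Riemannian manifold of dimension $n\ge 2$, let $\pi:T^*M\to M$ be its cotangent bundle, and put $t=\frac12 g^{-1}_{\pi(p)}(p,p)$ for $p\in T^*M$. For a vector $X$ and a covector $\theta$ at $\pi(p)$ let $X^H$ be the horizontal lift of $X$ to $p$ with respect to the Levi-Civita connection of $g$, let $\theta^V$ be the vertical lift of $\theta$ to $p$, put $g_X=g(X,\cdot)$, and let $\theta^\sharp$ be the vector with $g(\theta^\sharp,\cdot)=\theta$. Let $a_1,a_2,b_1,b_2,c_1,c_2,d_1,d_2,\lambda,\mu:[0,\infty)\to\mathbb R$ be smooth functions such that, for all $t\ge 0$, $$a_1,\ a_2,\ a_1+2tb_1,\ a_2+2tb_2,\ \lambda,\ \lambda+2t\mu>0,\qquad a_1a_2=1,\qquad (a_1+2tb_1)(a_2+2tb_2)=1,$$ $$c_1=\lambda a_1,\quad c_2=\lambda a_2,\quad c_1+2td_1=(\lambda+2t\mu)(a_1+2tb_1),\quad c_2+2td_2=(\lambda+2t\mu)(a_2+2tb_2).$$ Let $J$ and $G$ be the tensor fields on $T^*M$ given at $p$ by $$JX^H=a_1(t)\,(g_X)^V+b_1(t)\,p(X)\,p^V,\qquad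 J\theta^V=-a_2(t)\,(\theta^\sharp)^H-b_2(t)\,g^{-1}(p,\theta)\,(p^\sharp)^H,$$ $$G(X^H,Y^H)=c_1(t)\,g(X,Y)+d_1(t)\,p(X)p(Y),\qquad G(X^H,\theta^V)=G(\theta^V,X^H)=0,$$ $$G(\theta^V,\eta^V)=c_2(t)\,g^{-1}(\theta,\eta)+d_2(t)\,g^{-1}(p,\theta)\,g^{-1}(p,\eta).$$ Then $(G,J)$ is a (smooth) almost Hermitian structure on $T^*M$, and it is almost Kähler, i.e. its fundamental $2$-form $\phi(X,Y)=G(X,JY)$ is closed, if and only if $\mu=\lambda'$ on $[0,\infty)$ (with the one-sided derivative at $0$). -/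

import Mathlib

set_option maxSynthPendingDepth 3

open Set Bundle
open scoped Manifold ContDiff

noncomputable section

/-! ## Differential forms and almost Hermitian structures on a manifold without boundary -/

namespace DiffForm

variable {V : Type*} [NormedAddCommGroup V] [NormedSpace ℝ V]
  {H : Type*} [TopologicalSpace H] (I : ModelWithCorners ℝ V H)
  {N : Type*} [TopologicalSpace N] [ChartedSpace H N]

/-- A (not necessarily smooth) differential `k`-form: an alternating `k`-linear form on each
tangent space. -/
abbrev Form (N : Type*) [TopologicalSpace N] [ChartedSpace H N] (k : ℕ) : Type _ :=
  ∀ p : N, TangentSpace I p [⋀^Fin k]→L[ℝ] ℝ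

variable {I}

/-- The expression of a differential form in the distinguished chart at `p₀`, i.e. its pull-back by the
inverse of that chart. It is meaningful on the target of the chart. -/
def inChart {k : ℕ} (η : Form I N k) (p₀ : N) (y : V) : V [⋀^Fin k]→L[ℝ] ℝ :=
  (η ((extChartAt I p₀).symm y)).compContinuousLinearMap
    (mfderiv 𝓘(ℝ, V) I (extChartAt I p₀).symm y)

/-- A form on a manifold without boundary is smooth and closed if, in each chart of a covering
family of charts, its local expression is smooth and has zero exterior derivative. -/
def IsClosedForm [I.Boundaryless] {k : ℕ} (η : Form I N k) : Prop :=
  ∀ p₀ : N, ContDiffOn ℝ ∞ (inChart η p₀) (extChartAt I p₀).target ∧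
    ∀ y ∈ (extChartAt I p₀).target, extDeriv (inChart η p₀) y = 0

/-- The components of a field of bilinear forms in the distinguished chart at `p₀`. -/
def bilinInChart (G : ∀ p : N, TangentSpace I p →L[ℝ] TangentSpace I p →L[ℝ] ℝ)
    (p₀ : N) (y : V) : V →L[ℝ] V →L[ℝ] ℝ :=
  let A : V →L[ℝ] V := mfderiv 𝓘(ℝ, V) I (extChartAt I p₀).symm y
  (show V →L[ℝ] V →L[ℝ] ℝ from G ((extChartAt I p₀).symm y)).bilinearComp A A

/-- The components of a field of endomorphisms in the distinguished chart at `p₀`. -/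
def endoInChart (J : ∀ p : N, TangentSpace I p →L[ℝ] TangentSpace I p)
    (p₀ : N) (y : V) : V →L[ℝ] V :=
  let A : V →L[ℝ] V := mfderiv 𝓘(ℝ, V) I (extChartAt I p₀).symm y
  let B : V →L[ℝ] V := mfderiv I 𝓘(ℝ, V) (extChartAt I p₀) ((extChartAt I p₀).symm y)
  B ∘L (show V →L[ℝ] V from J ((extChartAt I p₀).symm y)) ∘L A

/-- `(G, J)` is an almost Hermitian structure on a manifold without boundary: `J` is a smooth
almost complex structure, `G` is a smooth Riemannian metric, and `G(JX, JY) = G(X, Y)`. -/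
structure IsAlmostHermitian [I.Boundaryless]
    (G : ∀ p : N, TangentSpace I p →L[ℝ] TangentSpace I p →L[ℝ] ℝ)
    (J : ∀ p : N, TangentSpace I p →L[ℝ] TangentSpace I p) : Prop where
  smooth_G : ∀ p₀ : N, ContDiffOn ℝ ∞ (bilinInChart G p₀) (extChartAt I p₀).target
  smooth_J : ∀ p₀ : N, ContDiffOn ℝ ∞ (endoInChart J p₀) (extChartAt I p₀).target
  sq_eq_neg : ∀ (p : N) (X : TangentSpace I p), J p (J p X) = -X
  symm : ∀ (p : N) (X Y : TangentSpace I p), G p X Y = G p Y X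
  pos : ∀ (p : N) (X : TangentSpace I p), X ≠ 0 → 0 < G p X X
  compat : ∀ (p : N) (X Y : TangentSpace I p), G p (J p X) (J p Y) = G p X Y

/-- The fundamental form `φ(X, Y) = G(X, JY)` of an almost Hermitian structure. -/
def fundamentalForm [I.Boundaryless]
    {G : ∀ p : N, TangentSpace I p →L[ℝ] TangentSpace I p →L[ℝ] ℝ}
    {J : ∀ p : N, TangentSpace I p →L[ℝ] TangentSpace I p}
    (h : IsAlmostHermitian G J) : Form I N 2 := fun p =>
  { toFun := fun v => G p (v 0) (J p (v 1))
    map_update_add' := by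
      intro _ v i x y
      fin_cases i <;> simp
    map_update_smul' := by
      intro _ v i c x
      fin_cases i <;> simp
    map_eq_zero_of_eq' := by
      have key : ∀ X : TangentSpace I p, G p X (J p X) = 0 := by
        intro X
        have h1 := h.compat p X (J p X)
        rw [h.sq_eq_neg, map_neg, h.symm p (J p X) X] at h1
        linarith
      intro v i j hv hij
      fin_cases i <;> fin_cases j <;> simp_all
    cont := by fun_prop }

/-- `(G, J)` is almost Kähler: it is almost Hermitian and its fundamental form is closed. -/
def IsAlmostKahler [I.Boundaryless]
    (G : ∀ p : N, TangentSpace I p →L[ℝ] TangentSpace I p →L[ℝ] ℝ)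
    (J : ∀ p : N, TangentSpace I p →L[ℝ] TangentSpace I p) : Prop :=
  ∃ h : IsAlmostHermitian G J, IsClosedForm (fundamentalForm h)

end DiffForm

/-! ## The cotangent bundle of a Riemannian manifold -/

namespace Cotangent

variable {E : Type*} [NormedAddCommGroup E] [NormedSpace ℝ E]
  {M : Type*} [TopologicalSpace M] [ChartedSpace E M] [IsManifold 𝓘(ℝ, E) ∞ M]

/-- The cotangent space `T*ₓM`. -/
abbrev Fiber (E : Type*) [NormedAddCommGroup E] [NormedSpace ℝ E] {M : Type*}
    [TopologicalSpace M] [ChartedSpace E M] (x : M) : Type _ :=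
  TangentSpace 𝓘(ℝ, E) x →L[ℝ] Trivial M ℝ x

/-- The total space `T*M`. Its distinguished chart at `p` is the chart
`(q, p) = (q¹, …, qⁿ, p₁, …, pₙ)` induced from the distinguished chart of `M` at `π(p)`. -/
abbrev Total (E : Type*) [NormedAddCommGroup E] [NormedSpace ℝ E] (M : Type*)
    [TopologicalSpace M] [ChartedSpace E M] [IsManifold 𝓘(ℝ, E) ∞ M] : Type _ :=
  TotalSpace (E →L[ℝ] ℝ) (fun x : M => Fiber E x)

/-- The model with corners (without boundary) of `T*M`. -/
abbrev model (E : Type*) [NormedAddCommGroup E] [NormedSpace ℝ E] :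
    ModelWithCorners ℝ (E × (E →L[ℝ] ℝ)) (ModelProd E (E →L[ℝ] ℝ)) :=
  𝓘(ℝ, E).prod 𝓘(ℝ, E →L[ℝ] ℝ)

/-- Smooth Riemannian metrics on `M`. -/
abbrev Metric (E : Type*) [NormedAddCommGroup E] [NormedSpace ℝ E] (M : Type*)
    [TopologicalSpace M] [ChartedSpace E M] [IsManifold 𝓘(ℝ, E) ∞ M] : Type _ :=
  ContMDiffRiemannianMetric 𝓘(ℝ, E) ∞ E (fun x : M => TangentSpace 𝓘(ℝ, E) x)

/-! Mathlib's tangent space at a point `x` of a manifold is by definition a copy of the model space,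
a vector being given by its components in the distinguished chart at `x`. So `T_xM` is a copy of
`E`, the cotangent space at `x` is a copy of `E →L[ℝ] ℝ`, and `T_pT*M` is a copy of
`E × (E →L[ℝ] ℝ)`, with the components in the induced chart `(qⁱ, pᵢ)`. These model spaces are
used below where it matters for instance search. -/

section Metric

variable (g : Metric E M) (x : M)

/-- The musical map `X ↦ g_X = g(X, ·)`, from `T_xM` to its dual. -/
def flat : E →L[ℝ] E →L[ℝ] ℝ := g.inner x

/-- The musical map `θ ↦ θ♯`, the inverse of `X ↦ g_X`. -/
def sharp : (E →L[ℝ] ℝ) →L[ℝ] E := (flat g x).inverse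

/-- `g(θ♯, Y) = θ(Y)`. -/
theorem flat_sharp [FiniteDimensional ℝ E] (θ : E →L[ℝ] ℝ) : flat g x (sharp g x θ) = θ := by
  have hinj : Function.Injective (flat g x : E →ₗ[ℝ] E →L[ℝ] ℝ) := by
    rw [injective_iff_map_eq_zero]
    intro v hv
    by_contra hne
    have h1 : 0 < flat g x v v := g.pos x v hne
    have h2 : flat g x v v = 0 := congrArg (fun f : E →L[ℝ] ℝ => f v) hv
    linarith
  have hdim : Module.finrank ℝ E = Module.finrank ℝ (E →L[ℝ] ℝ) := by
    rw [← (LinearMap.toContinuousLinearMap (𝕜 := ℝ) (E := E) (F' := ℝ)).finrank_eq]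
    exact Subspace.dual_finrank_eq.symm
  have he : flat g x = ((LinearEquiv.ofInjectiveOfFinrankEq (flat g x : E →ₗ[ℝ] E →L[ℝ] ℝ)
      hinj hdim).toContinuousLinearEquiv : E →L[ℝ] E →L[ℝ] ℝ) := by ext; rfl
  rw [sharp, he, ContinuousLinearMap.inverse_equiv]
  exact ContinuousLinearEquiv.apply_symm_apply _ _

/-- The components `g_ij` of the metric in the distinguished chart of `M` at `x`, as a bilinear form
depending on the point of the chart. -/
def metricInChart (y : E) : E →L[ℝ] E →L[ℝ] ℝ :=
  let A : E →L[ℝ] E := mfderiv 𝓘(ℝ, E) 𝓘(ℝ, E) (extChartAt 𝓘(ℝ, E) x).symm y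
  (flat g ((extChartAt 𝓘(ℝ, E) x).symm y)).bilinearComp A A

/-- The derivative at `x` of the components of the metric in the distinguished chart at `x`:
`metricDeriv g x u v w = uᵏ vⁱ wʲ ∂ₖ g_ij`. -/
def metricDeriv : E →L[ℝ] E →L[ℝ] E →L[ℝ] ℝ :=
  fderiv ℝ (metricInChart g x) (extChartAt 𝓘(ℝ, E) x x)

/-- The Christoffel symbols of the first kind at `x` in the distinguished chart at `x`, see
`christoffelFirst_apply`. -/
def christoffelFirst : E →L[ℝ] E →L[ℝ] E →L[ℝ] ℝ :=
  (1 / 2 : ℝ) • (metricDeriv g x + (metricDeriv g x).flip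
    - (ContinuousLinearMap.flipₗᵢ ℝ E E ℝ).toContinuousLinearEquiv.toContinuousLinearMap
      ∘L (metricDeriv g x).flip)

/-- `vⁱ wʲ uᵏ Γ_ijk = ½ vⁱ wʲ uᵏ (∂ᵢ g_jk + ∂ⱼ g_ik - ∂ₖ g_ij)`. -/
theorem christoffelFirst_apply (v w u : E) :
    christoffelFirst g x v w u = (1 / 2) * (metricDeriv g x v w u + metricDeriv g x w v u
      - metricDeriv g x u v w) := by
  simp [christoffelFirst]

/-- The Christoffel symbols `Γᵏᵢⱼ` of the Levi-Civita connection at `x`, in the distinguished chart at `x`: `christoffel g x v w = vⁱ wʲ Γᵏᵢⱼ ∂ₖ`. -/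
def christoffel : E →L[ℝ] E →L[ℝ] E :=
  (ContinuousLinearMap.compL ℝ E (E →L[ℝ] ℝ) E (sharp g x)) ∘L (christoffelFirst g x)

end Metric

section Lifts

variable (g : Metric E M) (p : Total E M)

/-- The point `p` of `T*M` as a linear form on the tangent space of `M` at `π(p)`. -/
def covector : E →L[ℝ] ℝ := p.2

/-- `g⁻¹(p, θ)`, as a linear form in `θ`. -/
def innerDual : (E →L[ℝ] ℝ) →L[ℝ] ℝ := (covector p) ∘L (sharp g p.1)

/-- The energy density `t = ½ ‖p‖² = ½ g⁻¹(p, p)`. -/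
def energy : ℝ := (1 / 2) * innerDual g p (covector p)

/-- The differential `π_*` at `p` of the projection `π : T*M → M`. -/
def projDeriv : E × (E →L[ℝ] ℝ) →L[ℝ] E :=
  mfderiv (model E) 𝓘(ℝ, E) (TotalSpace.proj : Total E M → M) p

/-- The differentials `(dp₁, …, dpₙ)` at `p` of the fibre coordinates of the induced chart, as one
covector-valued form. -/
def fiberCoordDeriv : E × (E →L[ℝ] ℝ) →L[ℝ] (E →L[ℝ] ℝ) :=
  mfderiv (model E) 𝓘(ℝ, E →L[ℝ] ℝ)
    (fun q : Total E M =>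
      (trivializationAt (E →L[ℝ] ℝ) (fun x : M => Fiber E x) p.1 q).2) p

/-- `Γ⁰ᵢₕ = pₖ Γᵏᵢₕ`, that is `christoffelZero g p v w = vⁱ wʰ Γ⁰ᵢₕ`. -/
def christoffelZero : E →L[ℝ] E →L[ℝ] ℝ :=
  (ContinuousLinearMap.compL ℝ E E ℝ (covector p)) ∘L (christoffel g p.1)

/-- The absolute differential `Dpₕ = dpₕ - Γ⁰ₕᵢ dqⁱ`. -/
def absDiff : E × (E →L[ℝ] ℝ) →L[ℝ] (E →L[ℝ] ℝ) :=
  fiberCoordDeriv p - (christoffelZero g p) ∘L (projDeriv p)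

/-- The vertical lift `θᵛ = θᵢ ∂/∂pᵢ` at `p`. -/
def vertLift : (E →L[ℝ] ℝ) →L[ℝ] E × (E →L[ℝ] ℝ) :=
  ContinuousLinearMap.inr ℝ E (E →L[ℝ] ℝ)

/-- The horizontal lift `Xᴴ = Xⁱ δ/δqⁱ = Xⁱ (∂/∂qⁱ + Γ⁰ᵢₕ ∂/∂pₕ)` at `p`. -/
def horLift : E →L[ℝ] E × (E →L[ℝ] ℝ) :=
  (ContinuousLinearMap.id ℝ E).prod (christoffelZero g p)

/-- The natural tensor field `J` of diagonal type at `p`: the endomorphism of `T_pT*M` with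
`J Xᴴ = a₁(t) (g_X)ᵛ + b₁(t) p(X) pᵛ` and
`J θᵛ = - a₂(t) (θ♯)ᴴ - b₂(t) g⁻¹(p, θ) (p♯)ᴴ`. -/
def complexStructure (a₁ a₂ b₁ b₂ : ℝ → ℝ) : E × (E →L[ℝ] ℝ) →L[ℝ] E × (E →L[ℝ] ℝ) :=
  let t := energy g p
  let J₁ : E →L[ℝ] E →L[ℝ] ℝ :=
    a₁ t • flat g p.1 + b₁ t • (covector p).smulRight (covector p)
  let J₂ : (E →L[ℝ] ℝ) →L[ℝ] E :=
    a₂ t • sharp g p.1 + b₂ t • (innerDual g p).smulRight (sharp g p.1 (covector p))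
  vertLift ∘L J₁ ∘L projDeriv p - horLift g p ∘L J₂ ∘L absDiff g p

/-- The natural metric `G` of diagonal type at `p`: horizontal and vertical vectors are orthogonal,
`G(Xᴴ, Yᴴ) = c₁(t) g(X, Y) + d₁(t) p(X) p(Y)` and
`G(θᵛ, ηᵛ) = c₂(t) g⁻¹(θ, η) + d₂(t) g⁻¹(p, θ) g⁻¹(p, η)`. -/
def liftedMetric (c₁ c₂ d₁ d₂ : ℝ → ℝ) :
    E × (E →L[ℝ] ℝ) →L[ℝ] E × (E →L[ℝ] ℝ) →L[ℝ] ℝ :=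
  let t := energy g p
  let G₁ : E →L[ℝ] E →L[ℝ] ℝ :=
    c₁ t • flat g p.1 + d₁ t • (covector p).smulRight (covector p)
  let G₂ : (E →L[ℝ] ℝ) →L[ℝ] (E →L[ℝ] ℝ) →L[ℝ] ℝ :=
    c₂ t • (ContinuousLinearMap.apply ℝ ℝ ∘L sharp g p.1)
      + d₂ t • (innerDual g p).smulRight (innerDual g p)
  G₁.bilinearComp (projDeriv p) (projDeriv p) + G₂.bilinearComp (absDiff g p) (absDiff g p)

/-- `complexStructure` as a tensor field on `T*M`. -/
def natJ (a₁ a₂ b₁ b₂ : ℝ → ℝ) (p : Total E M) :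
    TangentSpace (model E) p →L[ℝ] TangentSpace (model E) p :=
  complexStructure g p a₁ a₂ b₁ b₂

/-- `liftedMetric` as a tensor field on `T*M`. -/
def natG (c₁ c₂ d₁ d₂ : ℝ → ℝ) (p : Total E M) :
    TangentSpace (model E) p →L[ℝ] TangentSpace (model E) p →L[ℝ] ℝ :=
  liftedMetric g p c₁ c₂ d₁ d₂

end Lifts

end Cotangent

end

/-! Let α = pᵢ dqⁱ be the canonical 1-form, so that dα = dpᵢ ∧ dqⁱ. The theorem rests on the
identity φ = λ(t) dα + μ(t) dt ∧ α (`inChart_fundamentalForm`), in which the metric enters only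
through t. It has three sources. The algebraic relations between the coefficients make all of a, b,
c, d drop out of G(v, Jw), leaving λ and μ paired with Dp ∧ dq and g⁻¹(p, Dp) ∧ α
(`bilinOf_endoOf_vertical`). The Levi-Civita connection is torsion-free, so Dp ∧ dq = dp ∧ dq. It is
also metric, so g⁻¹(p, Dp) = dt (`fderiv_localEnergy`).

Differentiating, dφ = (λ' - μ) dt ∧ dα (`extDeriv_antisymm`), so μ = λ' suffices. Conversely, at a
covector p of energy t > 0 and for X ≠ 0 with p(X) = 0, which exists because n ≥ 2, the form dt ∧ dα
takes the value -2t g(X, X) on (pⱽ, Xᴴ, (g_X)ⱽ). Hence closedness forces λ' = μ for t > 0, and at t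
= 0 by continuity (`eq_derivWithin_of_isClosedForm`).

The tensors are defined at each point through the chart centred there, whereas smoothness and
exterior derivatives live in one fixed chart. The bridge is that the tensors of diagonal type are
natural under coordinate changes, which amounts to the transformation law of the Christoffel symbols
(`christoffelZeroOf_transform`, `exists_isTransported`). The almost Hermitian axioms that are
pointwise reduce to linear algebra in one tangent space. -/

noncomputable section

namespace Cotangent

/-! ## Linear algebra of the tensors of diagonal type at one point -/

section LinearAlgebra

variable {E : Type*} [NormedAddCommGroup E] [NormedSpace ℝ E]

/-- A positive definite symmetric bilinear form. -/
structure IsInner (b : E →L[ℝ] E →L[ℝ] ℝ) : Prop where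
  symm : ∀ v w, b v w = b w v
  pos : ∀ v, v ≠ 0 → 0 < b v v

/-! ### Musical isomorphisms and Cauchy–Schwarz. -/

namespace IsInner

variable {b : E →L[ℝ] E →L[ℝ] ℝ}

theorem nonneg (hb : IsInner b) (v : E) : 0 ≤ b v v := by
  by_cases h : v = 0
  · simp [h]
  · exact (hb.pos v h).le

theorem isInvertible [FiniteDimensional ℝ E] (hb : IsInner b) : b.IsInvertible := by
  have hinj : Function.Injective (b : E →ₗ[ℝ] E →L[ℝ] ℝ) := by
    rw [injective_iff_map_eq_zero]
    intro v hv
    by_contra hne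
    have h1 := hb.pos v hne
    have h2 : b v v = 0 := congrArg (fun f : E →L[ℝ] ℝ => f v) hv
    linarith
  have hdim : Module.finrank ℝ E = Module.finrank ℝ (E →L[ℝ] ℝ) := by
    rw [← (LinearMap.toContinuousLinearMap (𝕜 := ℝ) (E := E) (F' := ℝ)).finrank_eq]
    exact Subspace.dual_finrank_eq.symm
  exact ⟨(LinearEquiv.ofInjectiveOfFinrankEq (b : E →ₗ[ℝ] E →L[ℝ] ℝ)
      hinj hdim).toContinuousLinearEquiv, by ext; rfl⟩

variable [FiniteDimensional ℝ E]

@[simp] theorem apply_inverse (hb : IsInner b) (θ : E →L[ℝ] ℝ) : b (b.inverse θ) = θ :=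
  hb.isInvertible.self_apply_inverse θ

@[simp] theorem inverse_apply (hb : IsInner b) (v : E) : b.inverse (b v) = v :=
  hb.isInvertible.inverse_apply_self v

theorem apply_inverse_symm (hb : IsInner b) (θ η : E →L[ℝ] ℝ) :
    θ (b.inverse η) = η (b.inverse θ) := by
  have h1 : b (b.inverse θ) (b.inverse η) = θ (b.inverse η) := by rw [hb.apply_inverse]
  have h2 : b (b.inverse η) (b.inverse θ) = η (b.inverse θ) := by rw [hb.apply_inverse]
  rw [← h1, ← h2, hb.symm]

theorem inverse_nonneg (hb : IsInner b) (θ : E →L[ℝ] ℝ) : 0 ≤ θ (b.inverse θ) := by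
  have h := hb.nonneg (b.inverse θ)
  rwa [hb.apply_inverse] at h

theorem inverse_pos (hb : IsInner b) {θ : E →L[ℝ] ℝ} (hθ : θ ≠ 0) : 0 < θ (b.inverse θ) := by
  have h := hb.pos (b.inverse θ) (fun h0 => hθ (by rw [← hb.apply_inverse θ, h0, map_zero]))
  rwa [hb.apply_inverse] at h

theorem sq_apply_le (hb : IsInner b) (p : E →L[ℝ] ℝ) (v : E) :
    p v ^ 2 ≤ p (b.inverse p) * b v v := by
  by_cases hp : p = 0
  · simp [hp]
  have h0 := hb.inverse_pos hp
  -- With p♯ the dual vector of p, this is p(p♯) times the component of v orthogonal to p♯; its norm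
  -- is nonnegative.
  have h := hb.nonneg ((p (b.inverse p)) • v - (p v) • b.inverse p)
  have e1 : b (b.inverse p) v = p v := by rw [hb.apply_inverse]
  have e2 : b v (b.inverse p) = p v := by rw [hb.symm, e1]
  have e3 : b (b.inverse p) (b.inverse p) = p (b.inverse p) := by rw [hb.apply_inverse]
  simp only [map_sub, map_smul, sub_apply, smul_apply, smul_eq_mul, e1, e2, e3] at h
  have h' : 0 ≤ p (b.inverse p) * (p (b.inverse p) * b v v - p v ^ 2) := by
    linarith
  have := nonneg_of_mul_nonneg_right h' h0
  linarith

end IsInner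

/-- The energy density `½ b⁻¹(p, p)`. -/
def energyOf (b : E →L[ℝ] E →L[ℝ] ℝ) (p : E →L[ℝ] ℝ) : ℝ := (1 / 2) * p (b.inverse p)

/-- The endomorphism of diagonal type given by an inner product `b`, a covector `p`, and the
horizontal space `{(X, N X)}`. -/
def endoOf (b : E →L[ℝ] E →L[ℝ] ℝ) (p : E →L[ℝ] ℝ) (N : E →L[ℝ] E →L[ℝ] ℝ)
    (a₁ a₂ b₁ b₂ : ℝ) : E × (E →L[ℝ] ℝ) →L[ℝ] E × (E →L[ℝ] ℝ) :=
  ContinuousLinearMap.inr ℝ E (E →L[ℝ] ℝ) ∘L (a₁ • b + b₁ • p.smulRight p) ∘L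
      ContinuousLinearMap.fst ℝ E (E →L[ℝ] ℝ)
    - ((ContinuousLinearMap.id ℝ E).prod N) ∘L
      (a₂ • b.inverse + b₂ • (p ∘L b.inverse).smulRight (b.inverse p)) ∘L
      (ContinuousLinearMap.snd ℝ E (E →L[ℝ] ℝ) - N ∘L ContinuousLinearMap.fst ℝ E (E →L[ℝ] ℝ))

/-- The bilinear form of diagonal type given by an inner product `b`, a covector `p`, and the
horizontal space `{(X, N X)}`. -/
def bilinOf (b : E →L[ℝ] E →L[ℝ] ℝ) (p : E →L[ℝ] ℝ) (N : E →L[ℝ] E →L[ℝ] ℝ)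
    (c₁ c₂ d₁ d₂ : ℝ) : E × (E →L[ℝ] ℝ) →L[ℝ] E × (E →L[ℝ] ℝ) →L[ℝ] ℝ :=
  (c₁ • b + d₁ • p.smulRight p).bilinearComp (ContinuousLinearMap.fst ℝ E (E →L[ℝ] ℝ))
      (ContinuousLinearMap.fst ℝ E (E →L[ℝ] ℝ))
    + (c₂ • (ContinuousLinearMap.apply ℝ ℝ ∘L b.inverse)
      + d₂ • (p ∘L b.inverse).smulRight (p ∘L b.inverse)).bilinearComp
      (ContinuousLinearMap.snd ℝ E (E →L[ℝ] ℝ) - N ∘L ContinuousLinearMap.fst ℝ E (E →L[ℝ] ℝ))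
      (ContinuousLinearMap.snd ℝ E (E →L[ℝ] ℝ) - N ∘L ContinuousLinearMap.fst ℝ E (E →L[ℝ] ℝ))

variable {b : E →L[ℝ] E →L[ℝ] ℝ} {p : E →L[ℝ] ℝ} {N : E →L[ℝ] E →L[ℝ] ℝ}
  {a₁ a₂ b₁ b₂ c₁ c₂ d₁ d₂ l m : ℝ}

/-- A vector w has horizontal part w.1 and vertical part w.2 - N w.1, and J exchanges the two types.
This lemma and the next give both parts of Jw, and N never has to be unfolded again. -/
theorem endoOf_apply_fst (w : E × (E →L[ℝ] ℝ)) :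
    (endoOf b p N a₁ a₂ b₁ b₂ w).1 = -(a₂ • b.inverse (w.2 - N w.1)
      + (b₂ * p (b.inverse (w.2 - N w.1))) • b.inverse p) := by
  simp only [endoOf, sub_apply, ContinuousLinearMap.comp_apply, add_apply, smul_apply,
    ContinuousLinearMap.inr_apply, ContinuousLinearMap.prod_apply, ContinuousLinearMap.id_apply,
    ContinuousLinearMap.coe_fst', ContinuousLinearMap.coe_snd', ContinuousLinearMap.smulRight_apply,
    Prod.fst_sub, Prod.fst_add, Prod.smul_fst, map_add, map_sub, map_smul]
  module

theorem endoOf_apply_snd_sub (w : E × (E →L[ℝ] ℝ)) :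
    (endoOf b p N a₁ a₂ b₁ b₂ w).2 - N (endoOf b p N a₁ a₂ b₁ b₂ w).1
      = a₁ • b w.1 + (b₁ * p w.1) • p := by
  simp only [endoOf, sub_apply, ContinuousLinearMap.comp_apply, add_apply, smul_apply,
    ContinuousLinearMap.inr_apply, ContinuousLinearMap.prod_apply, ContinuousLinearMap.id_apply,
    ContinuousLinearMap.coe_fst', ContinuousLinearMap.coe_snd', ContinuousLinearMap.smulRight_apply,
    Prod.fst_sub, Prod.fst_add, Prod.smul_fst, Prod.snd_sub,
    Prod.snd_add, Prod.smul_snd, map_add, map_sub, map_smul, map_zero]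
  module

theorem bilinOf_apply (v w : E × (E →L[ℝ] ℝ)) :
    bilinOf b p N c₁ c₂ d₁ d₂ v w = c₁ * b v.1 w.1 + d₁ * (p v.1 * p w.1)
      + (c₂ * (w.2 - N w.1) (b.inverse (v.2 - N v.1))
        + d₂ * (p (b.inverse (v.2 - N v.1)) * p (b.inverse (w.2 - N w.1)))) := by
  simp [bilinOf]
  left
  ring

theorem ext_of_horizontal {v w : E × (E →L[ℝ] ℝ)} (h1 : v.1 = w.1)
    (h2 : v.2 - N v.1 = w.2 - N w.1) : v = w := by
  rw [h1] at h2
  exact Prod.ext h1 (sub_left_injective h2)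

/-- The algebraic relations between the values of the coefficient functions at `t`. -/
structure IsAdapted (t a₁ a₂ b₁ b₂ c₁ c₂ d₁ d₂ l m : ℝ) : Prop where
  a₁_pos : 0 < a₁
  a₂_pos : 0 < a₂
  ab₁_pos : 0 < a₁ + 2 * t * b₁
  ab₂_pos : 0 < a₂ + 2 * t * b₂
  l_pos : 0 < l
  lm_pos : 0 < l + 2 * t * m
  a_mul : a₁ * a₂ = 1
  ab_mul : (a₁ + 2 * t * b₁) * (a₂ + 2 * t * b₂) = 1
  c₁_eq : c₁ = l * a₁
  c₂_eq : c₂ = l * a₂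
  cd₁_eq : c₁ + 2 * t * d₁ = (l + 2 * t * m) * (a₁ + 2 * t * b₁)
  cd₂_eq : c₂ + 2 * t * d₂ = (l + 2 * t * m) * (a₂ + 2 * t * b₂)

theorem two_mul_energyOf : p (b.inverse p) = 2 * energyOf b p := by
  rw [energyOf]; ring

variable [FiniteDimensional ℝ E]

/-- The relations between the coefficients constrain b, d and μ only through 2t times them, which
says nothing at t = 0. But these coefficients always multiply p, and p = 0 when t = 0. -/
theorem IsInner.smul_eq_zero (hb : IsInner b) {k : ℝ} (hk : 2 * energyOf b p * k = 0) :
    k • p = 0 := by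
  by_cases hp : p = 0
  · simp [hp]
  · have h := hb.inverse_pos hp
    rw [two_mul_energyOf] at h
    rw [(mul_eq_zero.1 hk).resolve_left h.ne', zero_smul]

theorem IsInner.smul_inverse_eq_zero (hb : IsInner b) {k : ℝ} (hk : 2 * energyOf b p * k = 0) :
    k • b.inverse p = 0 := by
  rw [← map_smul, hb.smul_eq_zero hk, map_zero]

theorem endoOf_endoOf (hb : IsInner b)
    (h : IsAdapted (energyOf b p) a₁ a₂ b₁ b₂ c₁ c₂ d₁ d₂ l m) (w : E × (E →L[ℝ] ℝ)) :
    endoOf b p N a₁ a₂ b₁ b₂ (endoOf b p N a₁ a₂ b₁ b₂ w) = -w := by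
  set J := endoOf b p N a₁ a₂ b₁ b₂ with hJ
  have hp : p (b.inverse p) = 2 * energyOf b p := two_mul_energyOf
  set t := energyOf b p
  apply ext_of_horizontal (N := N)
  · have e := endoOf_apply_fst (b := b) (p := p) (N := N) (a₁ := a₁) (a₂ := a₂) (b₁ := b₁)
      (b₂ := b₂) (J w)
    rw [hJ, endoOf_apply_snd_sub, ← hJ] at e
    rw [e]
    -- Times 2t, this coefficient of p♯ is p(w.1) times the difference of (a₁ + 2tb₁)(a₂ + 2tb₂) and
    -- a₁a₂, both equal to 1.
    have hk : (a₂ * b₁ * p w.1 + b₂ * (a₁ * p w.1 + b₁ * p w.1 * (2 * t))) • b.inverse p = 0 := by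
      apply hb.smul_inverse_eq_zero
      linear_combination (p w.1) * h.ab_mul - (p w.1) * h.a_mul
    simp only [map_add, map_smul, hb.inverse_apply, hp, Prod.fst_neg, smul_eq_mul]
    rw [smul_add, smul_smul, smul_smul, mul_comm a₂ a₁, h.a_mul, one_smul, add_assoc, ← add_smul]
    rw [show a₂ * (b₁ * p w.1) + b₂ * (a₁ * p w.1 + b₁ * p w.1 * (2 * t))
      = a₂ * b₁ * p w.1 + b₂ * (a₁ * p w.1 + b₁ * p w.1 * (2 * t)) by ring, hk, add_zero]
  · rw [hJ, endoOf_apply_snd_sub, ← hJ]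
    have e := endoOf_apply_fst (b := b) (p := p) (N := N) (a₁ := a₁) (a₂ := a₂) (b₁ := b₁)
      (b₂ := b₂) w
    rw [← hJ] at e
    rw [e]
    set θ := w.2 - N w.1 with hθ
    have e2 : (-w).2 - N (-w).1 = -θ := by simp [hθ]; abel
    rw [e2]
    have hk : (a₁ * b₂ * p (b.inverse θ)
        + b₁ * (a₂ * p (b.inverse θ) + b₂ * p (b.inverse θ) * (2 * t))) • p = 0 := by
      apply hb.smul_eq_zero
      linear_combination (p (b.inverse θ)) * h.ab_mul - (p (b.inverse θ)) * h.a_mul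
    simp only [map_add, map_smul, map_neg, hb.apply_inverse, hp, smul_eq_mul]
    have : a₁ • -(a₂ • θ + (b₂ * p (b.inverse θ)) • p)
        + (b₁ * -(a₂ * p (b.inverse θ) + b₂ * p (b.inverse θ) * (2 * t))) • p
        = -((a₁ * a₂) • θ) - (a₁ * b₂ * p (b.inverse θ)
        + b₁ * (a₂ * p (b.inverse θ) + b₂ * p (b.inverse θ) * (2 * t))) • p := by
      module
    rw [this, hk, h.a_mul]
    simp

theorem bilinOf_symm (hb : IsInner b) (v w : E × (E →L[ℝ] ℝ)) :
    bilinOf b p N c₁ c₂ d₁ d₂ v w = bilinOf b p N c₁ c₂ d₁ d₂ w v := by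
  rw [bilinOf_apply, bilinOf_apply, hb.symm v.1, hb.apply_inverse_symm (w.2 - N w.1)]
  ring

/-- Here s stands for ‖v‖² and r for p(v), the bound on r² being Cauchy–Schwarz. For d < 0 the worst
case is r² = 2ts, where the value is (c + 2td)s. -/
theorem pos_of_sq_le {c d t s r : ℝ} (hc : 0 < c) (hcd : 0 < c + 2 * t * d) (hs : 0 < s)
    (hr : r ^ 2 ≤ 2 * t * s) : 0 < c * s + d * r ^ 2 := by
  rcases le_or_gt 0 d with hd | hd
  · have := mul_pos hc hs
    have := mul_nonneg hd (sq_nonneg r)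
    linarith
  · have h1 := mul_pos hcd hs
    have h2 := mul_le_mul_of_nonpos_left hr hd.le
    nlinarith

theorem IsAdapted.c₁_pos {t : ℝ} (h : IsAdapted t a₁ a₂ b₁ b₂ c₁ c₂ d₁ d₂ l m) : 0 < c₁ :=
  h.c₁_eq ▸ mul_pos h.l_pos h.a₁_pos

theorem IsAdapted.c₂_pos {t : ℝ} (h : IsAdapted t a₁ a₂ b₁ b₂ c₁ c₂ d₁ d₂ l m) : 0 < c₂ :=
  h.c₂_eq ▸ mul_pos h.l_pos h.a₂_pos

theorem bilinOf_pos (hb : IsInner b)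
    (h : IsAdapted (energyOf b p) a₁ a₂ b₁ b₂ c₁ c₂ d₁ d₂ l m) {w : E × (E →L[ℝ] ℝ)}
    (hw : w ≠ 0) : 0 < bilinOf b p N c₁ c₂ d₁ d₂ w w := by
  have hp : p (b.inverse p) = 2 * energyOf b p := two_mul_energyOf
  have hcd₁ : 0 < c₁ + 2 * energyOf b p * d₁ := h.cd₁_eq ▸ mul_pos h.lm_pos h.ab₁_pos
  have hcd₂ : 0 < c₂ + 2 * energyOf b p * d₂ := h.cd₂_eq ▸ mul_pos h.lm_pos h.ab₂_pos
  rw [bilinOf_apply, ← sq, ← sq]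
  set θ := w.2 - N w.1 with hθ
  have k1 : w.1 ≠ 0 → 0 < c₁ * b w.1 w.1 + d₁ * p w.1 ^ 2 := fun hne =>
    pos_of_sq_le h.c₁_pos hcd₁ (hb.pos _ hne) (hp ▸ hb.sq_apply_le p w.1)
  have k2 : θ ≠ 0 → 0 < c₂ * θ (b.inverse θ) + d₂ * p (b.inverse θ) ^ 2 := fun hne => by
    refine pos_of_sq_le h.c₂_pos hcd₂ (hb.inverse_pos hne) ?_
    have := hb.sq_apply_le p (b.inverse θ)
    rwa [hb.apply_inverse, hp] at this
  by_cases h1 : w.1 = 0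
  · have h2 : θ ≠ 0 := fun h2 => hw (ext_of_horizontal (N := N) (by simp [h1])
      (by rw [← hθ, h2]; simp))
    simpa [h1] using k2 h2
  · by_cases h2 : θ = 0
    · simpa [h2] using k1 h1
    · linarith [k1 h1, k2 h2]

/-- Off the direction of p, the products c₂a₁ and c₁a₂ both equal λ since a₁a₂ = 1; along p, the
corresponding products equal λ + 2tμ. So only λ and μ survive. -/
theorem bilinOf_endoOf_vertical (hb : IsInner b)
    (h : IsAdapted (energyOf b p) a₁ a₂ b₁ b₂ c₁ c₂ d₁ d₂ l m) (v w : E × (E →L[ℝ] ℝ)) :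
    bilinOf b p N c₁ c₂ d₁ d₂ v (endoOf b p N a₁ a₂ b₁ b₂ w)
      = l * ((v.2 - N v.1) w.1 - (w.2 - N w.1) v.1)
        + m * (p (b.inverse (v.2 - N v.1)) * p w.1 - p (b.inverse (w.2 - N w.1)) * p v.1) := by
  have hp : p (b.inverse p) = 2 * energyOf b p := two_mul_energyOf
  rw [bilinOf_apply, endoOf_apply_snd_sub, endoOf_apply_fst]
  set θ := v.2 - N v.1
  set η := w.2 - N w.1
  set t := energyOf b p
  have e1 : b w.1 (b.inverse θ) = θ w.1 := by rw [hb.symm, hb.apply_inverse]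
  have e2 : b v.1 (b.inverse η) = η v.1 := by rw [hb.symm, hb.apply_inverse]
  have e3 : b v.1 (b.inverse p) = p v.1 := by rw [hb.symm, hb.apply_inverse]
  simp only [map_add, map_smul, map_neg, add_apply, smul_apply,
    hb.inverse_apply, hp, smul_eq_mul, e1, e2, e3]
  -- The bracket vanishes after multiplication by 2t: (c₂ + 2td₂)(a₁ + 2tb₁) - c₂a₁ = (λ + 2tμ) - λ.
  -- `k2` is the same with the indices exchanged.
  have k1 : (c₂ * b₁ + d₂ * (a₁ + 2 * t * b₁) - m) * p w.1 = 0 := by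
    rw [← smul_eq_mul, ← smul_apply, hb.smul_eq_zero, zero_apply]
    linear_combination (a₁ + 2 * t * b₁) * h.cd₂_eq + (l + 2 * t * m) * h.ab_mul
      - a₁ * h.c₂_eq - l * h.a_mul
  have k2 : (c₁ * b₂ + d₁ * (a₂ + 2 * t * b₂) - m) * p v.1 = 0 := by
    rw [← smul_eq_mul, ← smul_apply, hb.smul_eq_zero, zero_apply]
    linear_combination (a₂ + 2 * t * b₂) * h.cd₁_eq + (l + 2 * t * m) * h.ab_mul
      - a₂ * h.c₁_eq - l * h.a_mul
  linear_combination p (b.inverse θ) * k1 - p (b.inverse η) * k2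
    + θ w.1 * (a₁ * h.c₂_eq + l * h.a_mul) - η v.1 * (a₂ * h.c₁_eq + l * h.a_mul)

/-- The formula for φ is visibly antisymmetric, so G(Jv, Jw) = φ(Jv, w) = -φ(w, Jv) = -G(w, J²v) =
G(v, w). -/
theorem bilinOf_endoOf_endoOf (hb : IsInner b)
    (h : IsAdapted (energyOf b p) a₁ a₂ b₁ b₂ c₁ c₂ d₁ d₂ l m) (v w : E × (E →L[ℝ] ℝ)) :
    bilinOf b p N c₁ c₂ d₁ d₂ (endoOf b p N a₁ a₂ b₁ b₂ v) (endoOf b p N a₁ a₂ b₁ b₂ w)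
      = bilinOf b p N c₁ c₂ d₁ d₂ v w := by
  have h1 := bilinOf_endoOf_vertical (N := N) hb h (endoOf b p N a₁ a₂ b₁ b₂ v) w
  have h2 := bilinOf_endoOf_vertical (N := N) hb h w (endoOf b p N a₁ a₂ b₁ b₂ v)
  rw [endoOf_endoOf hb h, map_neg, bilinOf_symm hb] at h2
  linarith

/-- Naturality of the tensors of diagonal type under a change of coordinates. -/
structure IsTransported (L : E ≃L[ℝ] E) (A : E × (E →L[ℝ] ℝ) →L[ℝ] E × (E →L[ℝ] ℝ))
    (b b' : E →L[ℝ] E →L[ℝ] ℝ) (p p' : E →L[ℝ] ℝ) (N N' : E →L[ℝ] E →L[ℝ] ℝ) : Prop where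
  inner : ∀ v w, b v w = b' (L v) (L w)
  covector : ∀ v, p v = p' (L v)
  fst : ∀ w, (A w).1 = L w.1
  absDiff : ∀ w v, ((A w).2 - N' (A w).1) (L v) = (w.2 - N w.1) v

namespace IsTransported

variable {L : E ≃L[ℝ] E} {A : E × (E →L[ℝ] ℝ) →L[ℝ] E × (E →L[ℝ] ℝ)}
    {b' : E →L[ℝ] E →L[ℝ] ℝ} {p' : E →L[ℝ] ℝ} {N' : E →L[ℝ] E →L[ℝ] ℝ}

theorem inverse (hT : IsTransported L A b b' p p' N N') (hb : IsInner b) (hb' : IsInner b')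
    {θ θ' : E →L[ℝ] ℝ} (hθ : ∀ v, θ' (L v) = θ v) : b'.inverse θ' = L (b.inverse θ) := by
  have : θ' = b' (L (b.inverse θ)) := by
    ext v
    obtain ⟨v, rfl⟩ := L.surjective v
    rw [hθ, ← hT.inner, hb.apply_inverse]
  rw [this, hb'.inverse_apply]

theorem energyOf_eq (hT : IsTransported L A b b' p p' N N') (hb : IsInner b)
    (hb' : IsInner b') : energyOf b' p' = energyOf b p := by
  rw [energyOf, energyOf, hT.inverse hb hb' (fun v => (hT.covector v).symm), ← hT.covector]

theorem bilinOf_eq (hT : IsTransported L A b b' p p' N N') (hb : IsInner b) (hb' : IsInner b')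
    (v w : E × (E →L[ℝ] ℝ)) :
    bilinOf b' p' N' c₁ c₂ d₁ d₂ (A v) (A w) = bilinOf b p N c₁ c₂ d₁ d₂ v w := by
  rw [bilinOf_apply, bilinOf_apply, hT.inverse hb hb' (hT.absDiff v),
    hT.inverse hb hb' (hT.absDiff w), hT.absDiff, hT.fst, hT.fst]
  simp only [← hT.inner, ← hT.covector]

theorem endoOf_eq (hT : IsTransported L A b b' p p' N N') (hb : IsInner b) (hb' : IsInner b')
    (w : E × (E →L[ℝ] ℝ)) :
    endoOf b' p' N' a₁ a₂ b₁ b₂ (A w) = A (endoOf b p N a₁ a₂ b₁ b₂ w) := by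
  apply ext_of_horizontal (N := N')
  · rw [hT.fst, endoOf_apply_fst, endoOf_apply_fst, hT.inverse hb hb' (hT.absDiff w),
      hT.inverse hb hb' (fun v => (hT.covector v).symm), ← hT.covector]
    simp only [map_neg, map_add, map_smul]
  · ext v
    obtain ⟨v, rfl⟩ := L.surjective v
    rw [hT.absDiff, endoOf_apply_snd_sub, endoOf_apply_snd_sub, hT.fst]
    simp only [add_apply, smul_apply, smul_eq_mul, ← hT.inner, ← hT.covector]

end IsTransported

end LinearAlgebra

/-! ### Christoffel symbols and their transformation law. -/

section Christoffel

variable {E : Type*} [NormedAddCommGroup E] [NormedSpace ℝ E]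

/-- The Christoffel symbols of the first kind, from the derivative `D u v w = uᵏ vⁱ wʲ ∂ₖ g_ij` of the
components of the metric. -/
def christoffelFirstOf (D : E →L[ℝ] E →L[ℝ] E →L[ℝ] ℝ) : E →L[ℝ] E →L[ℝ] E →L[ℝ] ℝ :=
  (1 / 2 : ℝ) • (D + D.flip
    - (ContinuousLinearMap.flipₗᵢ ℝ E E ℝ).toContinuousLinearEquiv.toContinuousLinearMap
      ∘L D.flip)

theorem christoffelFirstOf_apply (D : E →L[ℝ] E →L[ℝ] E →L[ℝ] ℝ) (v w u : E) :
    christoffelFirstOf D v w u = (1 / 2) * (D v w u + D w v u - D u v w) := by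
  simp [christoffelFirstOf]

/-- `pₖ Γᵏᵢⱼ`, from the components of the metric and their derivative. -/
def christoffelZeroOf (b : E →L[ℝ] E →L[ℝ] ℝ) (D : E →L[ℝ] E →L[ℝ] E →L[ℝ] ℝ)
    (p : E →L[ℝ] ℝ) : E →L[ℝ] E →L[ℝ] ℝ :=
  (ContinuousLinearMap.compL ℝ E E ℝ p) ∘L
    (ContinuousLinearMap.compL ℝ E (E →L[ℝ] ℝ) E b.inverse) ∘L christoffelFirstOf D

@[simp] theorem christoffelZeroOf_apply (b : E →L[ℝ] E →L[ℝ] ℝ)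
    (D : E →L[ℝ] E →L[ℝ] E →L[ℝ] ℝ) (p : E →L[ℝ] ℝ) (v w : E) :
    christoffelZeroOf b D p v w = p (b.inverse (christoffelFirstOf D v w)) := rfl

variable {b b' : E →L[ℝ] E →L[ℝ] ℝ} {D D' : E →L[ℝ] E →L[ℝ] E →L[ℝ] ℝ} {p p' : E →L[ℝ] ℝ}

theorem christoffelZeroOf_symm (hD : ∀ u v w, D u v w = D u w v) (v w : E) :
    christoffelZeroOf b D p v w = christoffelZeroOf b D p w v := by
  rw [christoffelZeroOf_apply, christoffelZeroOf_apply]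
  congr 2
  ext u
  rw [christoffelFirstOf_apply, christoffelFirstOf_apply, hD u v w]
  ring

variable [FiniteDimensional ℝ E]

/-- The transformation law of the Christoffel symbols. -/
theorem christoffelZeroOf_transform (L : E ≃L[ℝ] E) (Q : E →L[ℝ] E →L[ℝ] E)
    (hQ : ∀ v w, Q v w = Q w v) (hb : IsInner b) (hb' : IsInner b')
    (hbb : ∀ v w, b v w = b' (L v) (L w)) (hpp : ∀ v, p v = p' (L v))
    (hD : ∀ u v w, D u v w
      = D' (L u) (L v) (L w) + b' (Q u v) (L w) + b' (L v) (Q u w)) (v w : E) :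
    christoffelZeroOf b D p v w = christoffelZeroOf b' D' p' (L v) (L w) + p' (Q v w) := by
  -- `L` and `Q` play the roles of the first and second derivatives of a coordinate change. Of the
  -- six terms with `Q`, four cancel in pairs by symmetry and the other two add up.
  have h1 : ∀ u, christoffelFirstOf D v w u
      = christoffelFirstOf D' (L v) (L w) (L u) + b' (Q v w) (L u) := by
    intro u
    simp only [christoffelFirstOf_apply, hD]
    rw [hQ w v, hQ u w, hQ u v, hb'.symm (L w) (Q v u), hb'.symm (L v) (Q w u)]
    ring
  have h2 : b'.inverse (christoffelFirstOf D' (L v) (L w) + b' (Q v w))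
      = L (b.inverse (christoffelFirstOf D v w)) := by
    have : christoffelFirstOf D' (L v) (L w) + b' (Q v w)
        = b' (L (b.inverse (christoffelFirstOf D v w))) := by
      ext u
      obtain ⟨u, rfl⟩ := L.surjective u
      rw [← hbb, hb.apply_inverse, h1]
      rfl
    rw [this, hb'.inverse_apply]
  rw [christoffelZeroOf_apply, christoffelZeroOf_apply, hpp, ← h2, map_add, hb'.inverse_apply,
    map_add]

end Christoffel

/-! ### Smoothness in one chart and the differential of the energy. -/

section Local

variable {E : Type*} [NormedAddCommGroup E] [NormedSpace ℝ E]

/-- `pₖ Γᵏᵢⱼ` as a function of the coordinates on `T*M`, for a metric with components `h`. -/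
def localChristoffel (h : E → E →L[ℝ] E →L[ℝ] ℝ) (y : E × (E →L[ℝ] ℝ)) :
    E →L[ℝ] E →L[ℝ] ℝ :=
  christoffelZeroOf (h y.1) (fderiv ℝ h y.1) y.2

/-- The energy density as a function of the coordinates on `T*M`, for a metric with components
`h`. -/
def localEnergy (h : E → E →L[ℝ] E →L[ℝ] ℝ) (y : E × (E →L[ℝ] ℝ)) : ℝ :=
  energyOf (h y.1) y.2

variable {h : E → E →L[ℝ] E →L[ℝ] ℝ} {U : Set E}

theorem fderiv_apply_symm (hU : IsOpen U) (hh : ContDiffOn ℝ ∞ h U)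
    (hi : ∀ x ∈ U, IsInner (h x)) {x : E} (hx : x ∈ U) (u v w : E) :
    fderiv ℝ h x u v w = fderiv ℝ h x u w v := by
  have hd : HasFDerivAt h (fderiv ℝ h x) x :=
    ((hh.contDiffAt (hU.mem_nhds hx)).differentiableAt (by simp)).hasFDerivAt
  have k1 := (hd.clm_apply (hasFDerivAt_const v x)).clm_apply (hasFDerivAt_const w x)
  have k2 := (hd.clm_apply (hasFDerivAt_const w x)).clm_apply (hasFDerivAt_const v x)
  have k3 := k2.congr_of_eventuallyEq (f₁ := fun z => h z v w) (by
    filter_upwards [hU.mem_nhds hx] with z hz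
    exact (hi z hz).symm v w)
  have := congrArg (fun f : E →L[ℝ] ℝ => f u) (k1.unique k3)
  simpa using this

/-- Torsion-freeness: this is what allows Dp to be replaced by dp in the antisymmetrized pairing
with dq. -/
theorem localChristoffel_symm (hU : IsOpen U) (hh : ContDiffOn ℝ ∞ h U)
    (hi : ∀ x ∈ U, IsInner (h x)) {y : E × (E →L[ℝ] ℝ)} (hy : y.1 ∈ U) (v w : E) :
    localChristoffel h y v w = localChristoffel h y w v :=
  christoffelZeroOf_symm (fderiv_apply_symm hU hh hi hy) v w

variable [FiniteDimensional ℝ E]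

/-- Operator inversion is smooth at invertible operators, and positive definiteness supplies
invertibility. -/
theorem contDiffOn_sharp (hh : ContDiffOn ℝ ∞ h U)
    (hi : ∀ x ∈ U, IsInner (h x)) {θ : E × (E →L[ℝ] ℝ) → E →L[ℝ] ℝ}
    (hθ : ContDiffOn ℝ ∞ θ (U ×ˢ univ)) :
    ContDiffOn ℝ ∞ (fun y : E × (E →L[ℝ] ℝ) => (h y.1).inverse (θ y)) (U ×ˢ univ) := by
  have : CompleteSpace E := FiniteDimensional.complete ℝ E
  have h1 : ContDiffOn ℝ ∞ (fun y : E × (E →L[ℝ] ℝ) => h y.1) (U ×ˢ univ) :=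
    hh.comp contDiffOn_fst (fun y hy => hy.1)
  have h2 : ContDiffOn ℝ ∞ (fun y : E × (E →L[ℝ] ℝ) => (h y.1).inverse) (U ×ˢ univ) :=
    fun y hy => ContDiffAt.comp_contDiffWithinAt (g := ContinuousLinearMap.inverse) y
      (hi y.1 hy.1).isInvertible.contDiffAt_map_inverse (h1 y hy)
  exact h2.clm_apply hθ

theorem contDiffOn_localEnergy (hh : ContDiffOn ℝ ∞ h U) (hi : ∀ x ∈ U, IsInner (h x)) :
    ContDiffOn ℝ ∞ (localEnergy h) (U ×ˢ univ) := by
  unfold localEnergy energyOf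
  exact contDiffOn_const.mul (contDiffOn_snd.clm_apply (contDiffOn_sharp hh hi contDiffOn_snd))

theorem localEnergy_nonneg (hi : ∀ x ∈ U, IsInner (h x)) {y : E × (E →L[ℝ] ℝ)}
    (hy : y ∈ U ×ˢ (univ : Set (E →L[ℝ] ℝ))) : 0 ≤ localEnergy h y :=
  mul_nonneg (by norm_num) ((hi y.1 hy.1).inverse_nonneg y.2)

theorem contDiffOn_christoffelFirst (hU : IsOpen U) (hh : ContDiffOn ℝ ∞ h U) (v w : E) :
    ContDiffOn ℝ ∞ (fun x => christoffelFirstOf (fderiv ℝ h x) v w) U := by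
  have h1 : ContDiffOn ℝ ∞ (fderiv ℝ h) U := hh.fderiv_of_isOpen hU (by simp)
  rw [contDiffOn_clm_apply]
  intro u
  simp only [christoffelFirstOf_apply]
  have k : ∀ a b c : E, ContDiffOn ℝ ∞ (fun x => fderiv ℝ h x a b c) U := fun a b c =>
    ((h1.clm_apply contDiffOn_const).clm_apply contDiffOn_const).clm_apply contDiffOn_const
  exact contDiffOn_const.mul (((k _ _ _).add (k _ _ _)).sub (k _ _ _))

theorem contDiffOn_localChristoffel (hU : IsOpen U) (hh : ContDiffOn ℝ ∞ h U)
    (hi : ∀ x ∈ U, IsInner (h x)) : ContDiffOn ℝ ∞ (localChristoffel h) (U ×ˢ univ) := by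
  rw [contDiffOn_clm_apply]
  intro v
  rw [contDiffOn_clm_apply]
  intro w
  exact contDiffOn_snd.clm_apply (contDiffOn_sharp hh hi
    ((contDiffOn_christoffelFirst hU hh v w).comp contDiffOn_fst (fun y hy => hy.1)))

variable {a₁ a₂ b₁ b₂ : E × (E →L[ℝ] ℝ) → ℝ}

theorem contDiffOn_endoOf (hU : IsOpen U) (hh : ContDiffOn ℝ ∞ h U)
    (hi : ∀ x ∈ U, IsInner (h x)) (h₁ : ContDiffOn ℝ ∞ a₁ (U ×ˢ univ))
    (h₂ : ContDiffOn ℝ ∞ a₂ (U ×ˢ univ)) (h₃ : ContDiffOn ℝ ∞ b₁ (U ×ˢ univ))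
    (h₄ : ContDiffOn ℝ ∞ b₂ (U ×ˢ univ)) :
    ContDiffOn ℝ ∞ (fun y => endoOf (h y.1) y.2 (localChristoffel h y)
      (a₁ y) (a₂ y) (b₁ y) (b₂ y)) (U ×ˢ univ) := by
  have hN := contDiffOn_localChristoffel hU hh hi
  have h0 : ContDiffOn ℝ ∞ (fun y : E × (E →L[ℝ] ℝ) => h y.1) (U ×ˢ univ) :=
    hh.comp contDiffOn_fst (fun y hy => hy.1)
  have hp : ContDiffOn ℝ ∞ (fun y : E × (E →L[ℝ] ℝ) => y.2) (U ×ˢ univ) := contDiffOn_snd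
  rw [contDiffOn_clm_apply]
  intro w
  have hθ : ContDiffOn ℝ ∞ (fun y => w.2 - localChristoffel h y w.1) (U ×ˢ univ) :=
    contDiffOn_const.sub (hN.clm_apply contDiffOn_const)
  have hs := contDiffOn_sharp hh hi hθ
  have hf : ContDiffOn ℝ ∞ (fun y => (endoOf (h y.1) y.2 (localChristoffel h y)
      (a₁ y) (a₂ y) (b₁ y) (b₂ y) w).1) (U ×ˢ univ) := by
    simp only [endoOf_apply_fst]
    exact ((h₂.smul hs).add ((h₄.mul (hp.clm_apply hs)).smul (contDiffOn_sharp hh hi hp))).neg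
  refine hf.prodMk ?_
  have e : ∀ y, (endoOf (h y.1) y.2 (localChristoffel h y) (a₁ y) (a₂ y) (b₁ y) (b₂ y) w).2
      = (a₁ y • h y.1 w.1 + (b₁ y * y.2 w.1) • y.2) + localChristoffel h y
        (endoOf (h y.1) y.2 (localChristoffel h y) (a₁ y) (a₂ y) (b₁ y) (b₂ y) w).1 := fun y => by
    rw [← endoOf_apply_snd_sub (N := localChristoffel h y) (a₂ := a₂ y) (b₂ := b₂ y),
      sub_add_cancel]
  refine ContDiffOn.congr ?_ (fun y _ => e y)
  exact ((h₁.smul (h0.clm_apply contDiffOn_const)).add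
    ((h₃.mul (hp.clm_apply contDiffOn_const)).smul hp)).add (hN.clm_apply hf)

theorem contDiffOn_bilinOf (hU : IsOpen U) (hh : ContDiffOn ℝ ∞ h U)
    (hi : ∀ x ∈ U, IsInner (h x)) (h₁ : ContDiffOn ℝ ∞ a₁ (U ×ˢ univ))
    (h₂ : ContDiffOn ℝ ∞ a₂ (U ×ˢ univ)) (h₃ : ContDiffOn ℝ ∞ b₁ (U ×ˢ univ))
    (h₄ : ContDiffOn ℝ ∞ b₂ (U ×ˢ univ)) :
    ContDiffOn ℝ ∞ (fun y => bilinOf (h y.1) y.2 (localChristoffel h y)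
      (a₁ y) (a₂ y) (b₁ y) (b₂ y)) (U ×ˢ univ) := by
  have hN := contDiffOn_localChristoffel hU hh hi
  have h0 : ContDiffOn ℝ ∞ (fun y : E × (E →L[ℝ] ℝ) => h y.1) (U ×ˢ univ) :=
    hh.comp contDiffOn_fst (fun y hy => hy.1)
  have hp : ContDiffOn ℝ ∞ (fun y : E × (E →L[ℝ] ℝ) => y.2) (U ×ˢ univ) := contDiffOn_snd
  rw [contDiffOn_clm_apply]
  intro v
  rw [contDiffOn_clm_apply]
  intro w
  have hθ : ∀ w : E × (E →L[ℝ] ℝ),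
      ContDiffOn ℝ ∞ (fun y => w.2 - localChristoffel h y w.1) (U ×ˢ univ) := fun w =>
    contDiffOn_const.sub (hN.clm_apply contDiffOn_const)
  have hs := fun w => contDiffOn_sharp hh hi (hθ w)
  simp only [bilinOf_apply]
  exact ((h₁.mul ((h0.clm_apply contDiffOn_const).clm_apply contDiffOn_const)).add
    (h₃.mul ((hp.clm_apply contDiffOn_const).mul (hp.clm_apply contDiffOn_const)))).add
    ((h₂.mul ((hθ w).clm_apply (hs v))).add
      (h₄.mul ((hp.clm_apply (hs v)).mul (hp.clm_apply (hs w)))))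

/-- The differential of the energy density is `g⁻¹(p, Dp)`. -/
theorem fderiv_localEnergy (hU : IsOpen U) (hh : ContDiffOn ℝ ∞ h U)
    (hi : ∀ x ∈ U, IsInner (h x)) {y : E × (E →L[ℝ] ℝ)}
    (hy : y ∈ U ×ˢ (univ : Set (E →L[ℝ] ℝ))) (w : E × (E →L[ℝ] ℝ)) :
    fderiv ℝ (localEnergy h) y w
      = y.2 ((h y.1).inverse (w.2 - localChristoffel h y w.1)) := by
  have hb := hi y.1 hy.1
  have hO : IsOpen (U ×ˢ (univ : Set (E →L[ℝ] ℝ))) := hU.prod isOpen_univ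
  have hnhds := hO.mem_nhds hy
  set s : E × (E →L[ℝ] ℝ) → E := fun y => (h y.1).inverse y.2 with hs
  have hsd : HasFDerivAt s (fderiv ℝ s y) y :=
    (((contDiffOn_sharp hh hi contDiffOn_snd).contDiffAt hnhds).differentiableAt
      (by simp)).hasFDerivAt
  have hhd : HasFDerivAt (fun y : E × (E →L[ℝ] ℝ) => h y.1)
      ((fderiv ℝ h y.1) ∘L ContinuousLinearMap.fst ℝ E (E →L[ℝ] ℝ)) y :=
    HasFDerivAt.comp y (((hh.contDiffAt (hU.mem_nhds hy.1)).differentiableAt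
      (by simp)).hasFDerivAt) hasFDerivAt_fst
  have hpd : HasFDerivAt (fun y : E × (E →L[ℝ] ℝ) => y.2)
      (ContinuousLinearMap.snd ℝ E (E →L[ℝ] ℝ)) y := hasFDerivAt_snd
  -- Differentiate g(p♯) = p along w. Evaluated at p♯ this gives p(∂p♯) in terms of w.2(p♯) and
  -- (∂g)(p♯, p♯), so the derivative of p♯ can be eliminated from dt.
  have e1 : fderiv ℝ h y.1 w.1 (s y) + h y.1 (fderiv ℝ s y w) = w.2 := by
    have k1 := hhd.clm_apply hsd
    have k2 : HasFDerivAt (fun y => h y.1 (s y)) (ContinuousLinearMap.snd ℝ E (E →L[ℝ] ℝ)) y := by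
      refine hpd.congr_of_eventuallyEq ?_
      filter_upwards [hnhds] with z hz
      exact (hi z.1 hz.1).apply_inverse z.2
    have := congrArg (fun f : E × (E →L[ℝ] ℝ) →L[ℝ] (E →L[ℝ] ℝ) => f w) (k1.unique k2)
    simpa [add_comm] using this
  have e2 : fderiv ℝ (localEnergy h) y w = (1 / 2) * (y.2 (fderiv ℝ s y w) + w.2 (s y)) := by
    have k : HasFDerivAt (localEnergy h) _ y := (hpd.clm_apply hsd).const_mul (1 / 2)
    rw [k.fderiv]
    simp [mul_add]
  have e3 : ∀ v, y.2 v = h y.1 v (s y) := fun v => by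
    rw [hb.symm, hs]; simp only [hb.apply_inverse]
  have e4 : y.2 ((h y.1).inverse (w.2 - localChristoffel h y w.1))
      = w.2 (s y) - localChristoffel h y w.1 (s y) := by
    rw [hb.apply_inverse_symm]; rfl
  -- With two arguments equal to p♯, two of the three terms of the Christoffel symbol cancel.
  have e5 : localChristoffel h y w.1 (s y) = (1 / 2) * fderiv ℝ h y.1 w.1 (s y) (s y) := by
    rw [localChristoffel, christoffelZeroOf_apply, hb.apply_inverse_symm]
    change christoffelFirstOf _ _ _ (s y) = _
    rw [christoffelFirstOf_apply]
    ring
  have e6 := congrArg (fun f : E →L[ℝ] ℝ => f (s y)) e1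
  simp only [add_apply] at e6
  rw [e2, e4, e5, e3]
  linarith

end Local

/-! ### The exterior derivative of l(T) dα + m(T) dT ∧ α. -/

section ClosedForm

variable {V : Type*} [NormedAddCommGroup V] [NormedSpace ℝ V]

/-- The antisymmetrization `(v, w) ↦ B(v, w) - B(w, v)`. -/
def antisymm (V : Type*) [NormedAddCommGroup V] [NormedSpace ℝ V] :
    (V →L[ℝ] V →L[ℝ] ℝ) →L[ℝ] V [⋀^Fin 2]→L[ℝ] ℝ :=
  ContinuousAlternatingMap.alternatizeUncurryFinCLM ℝ V ℝ ∘L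
    ContinuousLinearMap.compL ℝ V (V →L[ℝ] ℝ) (V [⋀^Fin 1]→L[ℝ] ℝ)
      (ContinuousAlternatingMap.ofSubsingletonLIE (𝕜 := ℝ) (E := V) (F := ℝ)
        (0 : Fin 1)).toContinuousLinearEquiv.toContinuousLinearMap

theorem antisymm_apply (B : V →L[ℝ] V →L[ℝ] ℝ) (v : Fin 2 → V) :
    antisymm V B v = B (v 0) (v 1) - B (v 1) (v 0) := by
  simp [antisymm, ContinuousAlternatingMap.alternatizeUncurryFin_apply, Fin.sum_univ_two,
    Fin.removeNth, sub_eq_add_neg]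

/-- The exterior derivative of `l(T) dα + m(T) dT ∧ α`, where `α_z = Ω(z, ·)`. -/
theorem extDeriv_antisymm (Ω : V →L[ℝ] V →L[ℝ] ℝ) {T : V → ℝ} {y : V} (hT : ContDiffAt ℝ ∞ T y)
    (hT0 : ∀ᶠ z in nhds y, 0 ≤ T z) {l m : ℝ → ℝ} {l' : ℝ}
    (hl : HasDerivWithinAt l l' (Ici 0) (T y))
    (hm : DifferentiableWithinAt ℝ m (Ici 0) (T y)) (v : Fin 3 → V) :
    extDeriv (fun z => antisymm V (l (T z) • Ω + m (T z) • (fderiv ℝ T z).smulRight (Ω z))) y v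
      = (l' - m (T y)) * (fderiv ℝ T y (v 0) * (Ω (v 1) (v 2) - Ω (v 2) (v 1))
        - fderiv ℝ T y (v 1) * (Ω (v 0) (v 2) - Ω (v 2) (v 0))
        + fderiv ℝ T y (v 2) * (Ω (v 0) (v 1) - Ω (v 1) (v 0))) := by
  have hTd : HasFDerivAt T (fderiv ℝ T y) y := (hT.differentiableAt (by simp)).hasFDerivAt
  have hT2 : HasFDerivAt (fderiv ℝ T) (fderiv ℝ (fderiv ℝ T) y) y :=
    ((hT.fderiv_right (m := ∞) (by simp)).differentiableAt (by simp)).hasFDerivAt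
  -- This encodes d(dT) = 0.
  have hsymm : ∀ u w, fderiv ℝ (fderiv ℝ T) y u w = fderiv ℝ (fderiv ℝ T) y w u := fun u w =>
    (hT.isSymmSndFDerivAt (by rw [minSmoothness_of_isRCLikeNormedField]; exact WithTop.coe_le_coe.2 (le_top : (2 : ℕ∞) ≤ ⊤))) u w
  -- The coefficients are differentiable only within [0, ∞), and T may be 0 at y. Since T ≥ 0 near
  -- y, the one-sided derivative still obeys the chain rule.
  have comp : ∀ {f : ℝ → ℝ} {f' : ℝ}, HasDerivWithinAt f f' (Ici 0) (T y) →
      HasFDerivAt (fun z => f (T z)) (f' • fderiv ℝ T y) y := by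
    intro f f' hf
    exact hf.comp_hasFDerivAt y hTd hT0
  have hlT := comp hl
  have hmT := comp hm.hasDerivWithinAt
  -- The value of this derivative plays no role: it multiplies dT ∧ dT ∧ α.
  set m' := derivWithin m (Ici 0) (T y)
  have hΩ : HasFDerivAt (fun z => Ω z) Ω y := Ω.hasFDerivAt
  have hB := (hlT.smul_const Ω).add (hmT.smul
    ((ContinuousLinearMap.smulRightL ℝ V (V →L[ℝ] ℝ)).hasFDerivAt_of_bilinear hT2 hΩ))
  set B' := (l' • fderiv ℝ T y).smulRight Ω + _ with hB'
  have key : ∀ u a b, B' u a b = l' * fderiv ℝ T y u * Ω a b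
      + (m (T y) * (fderiv ℝ T y a * Ω u b + fderiv ℝ (fderiv ℝ T) y u a * Ω y b)
        + m' * fderiv ℝ T y u * (fderiv ℝ T y a * Ω y b)) := fun u a b => by
    rw [hB']
    rfl
  have hφ : HasFDerivAt (fun z => antisymm V (l (T z) • Ω + m (T z) •
      (fderiv ℝ T z).smulRight (Ω z))) (antisymm V ∘L B') y := (antisymm V).hasFDerivAt.comp y hB
  rw [extDeriv, hφ.fderiv, ContinuousAlternatingMap.alternatizeUncurryFin_apply,
    Fin.sum_univ_three]
  simp only [ContinuousLinearMap.comp_apply, antisymm_apply, key, Fin.removeNth]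
  rw [show Fin.succAbove (0 : Fin 3) 0 = 1 from rfl, show Fin.succAbove (0 : Fin 3) 1 = 2 from rfl,
    show Fin.succAbove (1 : Fin 3) 0 = 0 from rfl, show Fin.succAbove (1 : Fin 3) 1 = 2 from rfl,
    show Fin.succAbove (2 : Fin 3) 0 = 0 from rfl, show Fin.succAbove (2 : Fin 3) 1 = 1 from rfl,
    hsymm (v 1) (v 0), hsymm (v 2) (v 0), hsymm (v 2) (v 1)]
  simp only [Fin.val_zero, Fin.val_one, Fin.val_two, zsmul_eq_mul]
  ring

end ClosedForm

/-! ### Naturality under a change of coordinates. -/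

section CoordChange

variable {E : Type*} [NormedAddCommGroup E] [NormedSpace ℝ E] [FiniteDimensional ℝ E]

/-- A change of coordinates `τ` of the base transports the tensors of diagonal type, if the metric
and the fibre coordinates transform as they should. -/
theorem isTransported_of_coordChange {h h' : E → E →L[ℝ] E →L[ℝ] ℝ} {τ : E → E}
    {Ψ : E × (E →L[ℝ] ℝ) → E × (E →L[ℝ] ℝ)} {y : E × (E →L[ℝ] ℝ)} {L : E ≃L[ℝ] E}
    {A : E × (E →L[ℝ] ℝ) →L[ℝ] E × (E →L[ℝ] ℝ)}
    (hτ : ContDiffAt ℝ ∞ τ y.1) (hL : fderiv ℝ τ y.1 = L)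
    (hh : DifferentiableAt ℝ h y.1) (hh' : DifferentiableAt ℝ h' (Ψ y).1)
    (hhh : ∀ᶠ z in nhds y.1, ∀ v w, h z v w = h' (τ z) (fderiv ℝ τ z v) (fderiv ℝ τ z w))
    (hΨ : HasFDerivAt Ψ A y) (hΨ₁ : ∀ᶠ z in nhds y, (Ψ z).1 = τ z.1)
    (hΨ₂ : ∀ᶠ z in nhds y, ∀ v, z.2 v = (Ψ z).2 (fderiv ℝ τ z.1 v))
    (hb : IsInner (h y.1)) (hb' : IsInner (h' (Ψ y).1)) :
    IsTransported L A (h y.1) (h' (Ψ y).1) y.2 (Ψ y).2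
      (localChristoffel h y) (localChristoffel h' (Ψ y)) := by
  have hτy := hΨ₁.self_of_nhds
  have hτd : HasFDerivAt τ (L : E →L[ℝ] E) y.1 :=
    hL ▸ (hτ.differentiableAt (by simp)).hasFDerivAt
  set Q := fderiv ℝ (fderiv ℝ τ) y.1
  have hτ2 : HasFDerivAt (fderiv ℝ τ) Q y.1 :=
    ((hτ.fderiv_right (m := ∞) (by simp)).differentiableAt (by simp)).hasFDerivAt
  have hQ : ∀ v w, Q v w = Q w v := fun v w =>
    (hτ.isSymmSndFDerivAt (by
      rw [minSmoothness_of_isRCLikeNormedField]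
      exact WithTop.coe_le_coe.2 (le_top : (2 : ℕ∞) ≤ ⊤))) v w
  have hinner : ∀ v w, h y.1 v w = h' (Ψ y).1 (L v) (L w) := by
    intro v w
    rw [hhh.self_of_nhds, hτy, hL]
    rfl
  have hcov : ∀ v, y.2 v = (Ψ y).2 (L v) := by
    intro v
    rw [hΨ₂.self_of_nhds, hL]
    rfl
  have hfst : ∀ w, (A w).1 = L w.1 := by
    intro w
    have k1 : HasFDerivAt (fun z => (Ψ z).1) ((ContinuousLinearMap.fst ℝ E _) ∘L A) y := hΨ.fst
    have k2 : HasFDerivAt (fun z : E × (E →L[ℝ] ℝ) => τ z.1)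
        ((L : E →L[ℝ] E) ∘L (ContinuousLinearMap.fst ℝ E _)) y :=
      HasFDerivAt.comp y hτd hasFDerivAt_fst
    exact congrArg (fun f : E × (E →L[ℝ] ℝ) →L[ℝ] E => f w)
      (k1.unique (k2.congr_of_eventuallyEq hΨ₁))
  -- Differentiate the transformation law of the fibre coordinates. The term with `Q` is the failure
  -- of dp to be tensorial.
  have hsnd : ∀ w v, w.2 v = (A w).2 (L v) + (Ψ y).2 (Q w.1 v) := by
    intro w v
    have k1 : HasFDerivAt (fun z : E × (E →L[ℝ] ℝ) => z.2 v) _ y :=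
      (hasFDerivAt_snd (𝕜 := ℝ) (p := y)).clm_apply (hasFDerivAt_const v y)
    have k2 : HasFDerivAt (fun z => (Ψ z).2) ((ContinuousLinearMap.snd ℝ E _) ∘L A) y := hΨ.snd
    have k3 : HasFDerivAt (fun z : E × (E →L[ℝ] ℝ) => fderiv ℝ τ z.1)
        (Q ∘L (ContinuousLinearMap.fst ℝ E _)) y := HasFDerivAt.comp y hτ2 hasFDerivAt_fst
    have k4 := k2.clm_apply (k3.clm_apply (hasFDerivAt_const v y))
    have := congrArg (fun f : E × (E →L[ℝ] ℝ) →L[ℝ] ℝ => f w)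
      (k1.unique (k4.congr_of_eventuallyEq (hΨ₂.mono fun z hz => hz v)))
    simpa [hL, add_comm] using this
  have hder : ∀ u v w, fderiv ℝ h y.1 u v w = fderiv ℝ h' (Ψ y).1 (L u) (L v) (L w)
      + h' (Ψ y).1 (Q u v) (L w) + h' (Ψ y).1 (L v) (Q u w) := by
    intro u v w
    have k1 := (hh.hasFDerivAt.clm_apply (hasFDerivAt_const v y.1)).clm_apply
      (hasFDerivAt_const w y.1)
    rw [hτy] at hh' ⊢
    have k2 : HasFDerivAt (fun z => h' (τ z)) ((fderiv ℝ h' (τ y.1)) ∘L (L : E →L[ℝ] E)) y.1 :=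
      HasFDerivAt.comp y.1 hh'.hasFDerivAt hτd
    have k3 := (k2.clm_apply (hτ2.clm_apply (hasFDerivAt_const v y.1))).clm_apply
      (hτ2.clm_apply (hasFDerivAt_const w y.1))
    have := congrArg (fun f : E →L[ℝ] ℝ => f u)
      (k1.unique (k3.congr_of_eventuallyEq (hhh.mono fun z hz => hz v w)))
    simp [hL] at this
    rw [this]
    ring
  refine ⟨hinner, hcov, hfst, fun w v => ?_⟩
  -- The Christoffel symbols produce the same term with `Q` as dp, so it cancels in Dp.
  have k := christoffelZeroOf_transform L Q hQ hb hb' hinner hcov hder w.1 v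
  simp only [sub_apply]
  rw [hsnd w v, hfst]
  simp only [localChristoffel]
  rw [k]
  ring

end CoordChange

/-! ### The induced charts of the cotangent bundle. -/

section Charts

variable {E : Type*} [NormedAddCommGroup E] [NormedSpace ℝ E]
  {M : Type*} [TopologicalSpace M] [ChartedSpace E M] [IsManifold 𝓘(ℝ, E) ∞ M]

/-- The trivialization used by the chart lives over the whole chart domain in M, so no further
restriction of the base occurs. -/
theorem extChartAt_target_eq (p : Total E M) :
    (extChartAt (model E) p).target
      = (extChartAt 𝓘(ℝ, E) p.1).target ×ˢ (univ : Set (E →L[ℝ] ℝ)) := by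
  rw [FiberBundle.extChartAt_target]
  congr 1
  rw [inter_eq_left]
  intro z hz
  have h := (extChartAt 𝓘(ℝ, E) p.1).map_target hz
  rw [extChartAt_source] at h
  simpa using h

theorem fst_mem_target (p₀ : Total E M) {y : E × (E →L[ℝ] ℝ)}
    (hy : y ∈ (extChartAt (model E) p₀).target) :
    y.1 ∈ (extChartAt 𝓘(ℝ, E) p₀.1).target := by
  rw [extChartAt_target_eq] at hy
  exact hy.1

theorem extChartAt_source_eq (p : Total E M) :
    (extChartAt (model E) p).source
      = TotalSpace.proj ⁻¹' (extChartAt 𝓘(ℝ, E) p.1).source := by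
  rw [FiberBundle.extChartAt]
  ext q
  simp only [PartialEquiv.trans_source, Trivialization.source_eq, mem_inter_iff, mem_preimage,
    PartialEquiv.prod_source, mem_prod, extChartAt_source, PartialEquiv.refl_source]
  constructor
  · exact fun h => h.2.1
  · exact fun h => ⟨by simpa using h, h, trivial⟩

theorem extChartAt_apply_fst (p q : Total E M) :
    (extChartAt (model E) p q).1 = extChartAt 𝓘(ℝ, E) p.1 q.1 := by
  rw [FiberBundle.extChartAt]
  rfl

theorem extChartAt_symm_proj (p : Total E M) {y : E × (E →L[ℝ] ℝ)}
    (hy : y ∈ (extChartAt (model E) p).target) :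
    ((extChartAt (model E) p).symm y).1 = (extChartAt 𝓘(ℝ, E) p.1).symm y.1 := by
  have h1 := (extChartAt (model E) p).map_target hy
  rw [extChartAt_source_eq] at h1
  have h2 := congrArg Prod.fst ((extChartAt (model E) p).right_inv hy)
  rw [extChartAt_apply_fst] at h2
  rw [← h2]
  exact ((extChartAt 𝓘(ℝ, E) p.1).left_inv h1).symm

/-- This is pᵢ = p(∂/∂qⁱ), the coordinate vectors being the images of the basis under the
differential of the inverse chart. -/
theorem extChartAt_apply_snd (p q : Total E M)
    (hq : q.1 ∈ (extChartAt 𝓘(ℝ, E) p.1).source) (v : E) :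
    (extChartAt (model E) p q).2 v = covector q
      ((mfderiv 𝓘(ℝ, E) 𝓘(ℝ, E) (extChartAt 𝓘(ℝ, E) p.1).symm
        (extChartAt 𝓘(ℝ, E) p.1 q.1) : E →L[ℝ] E) v) := by
  have : IsManifold 𝓘(ℝ, E) 1 M := IsManifold.of_le (n := ∞) (by simp)
  rw [extChartAt_source] at hq
  have h := TangentBundle.symmL_trivializationAt (I := 𝓘(ℝ, E)) (𝕜 := ℝ) hq
  rw [modelWithCornersSelf_coe, range_id, mfderivWithin_univ] at h
  rw [← h, FiberBundle.extChartAt]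
  change (ContinuousLinearMap.inCoordinates _ _ _ _ _ _ _ _ _) v = _
  rw [ContinuousLinearMap.inCoordinates]
  simp
  rfl

theorem mfderiv_extChartAt_symm_self (x : M) :
    (mfderiv 𝓘(ℝ, E) 𝓘(ℝ, E) (extChartAt 𝓘(ℝ, E) x).symm (extChartAt 𝓘(ℝ, E) x x) : E →L[ℝ] E)
      = ContinuousLinearMap.id ℝ E := by
  have : IsManifold 𝓘(ℝ, E) 1 M := IsManifold.of_le (n := ∞) (by simp)
  rw [← mfderivWithin_univ]
  have := mfderivWithin_range_extChartAt_symm (I := 𝓘(ℝ, E)) (x := x)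
  rw [modelWithCornersSelf_coe, range_id] at this
  exact this

/-- Read in the charts at p and at π(p), which also identify the tangent spaces with their models, π
is the first linear projection. The next lemma does the same for the fibre coordinates. -/
theorem projDeriv_eq (p : Total E M) : projDeriv p = ContinuousLinearMap.fst ℝ E (E →L[ℝ] ℝ) := by
  have h : HasMFDerivAt (model E) 𝓘(ℝ, E) (TotalSpace.proj : Total E M → M) p
      (ContinuousLinearMap.fst ℝ E (E →L[ℝ] ℝ)) := by
    have key : ∀ y ∈ (extChartAt (model E) p).target,
        extChartAt 𝓘(ℝ, E) p.1 ((extChartAt (model E) p).symm y).1 = y.1 := by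
      intro y hy
      have hy' := hy
      rw [extChartAt_target_eq] at hy'
      rw [extChartAt_symm_proj p hy]
      exact (extChartAt 𝓘(ℝ, E) p.1).right_inv hy'.1
    refine ⟨(FiberBundle.continuous_proj _ _).continuousAt,
      (hasFDerivAt_fst.hasFDerivWithinAt).congr_of_eventuallyEq ?_
        (key _ (mem_extChartAt_target p))⟩
    filter_upwards [extChartAt_target_mem_nhdsWithin p] with y hy using key y hy
  exact h.mfderiv

theorem fiberCoordDeriv_eq (p : Total E M) :
    fiberCoordDeriv p = ContinuousLinearMap.snd ℝ E (E →L[ℝ] ℝ) := by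
  have h : HasMFDerivAt (model E) 𝓘(ℝ, E →L[ℝ] ℝ) (fun q : Total E M =>
      (trivializationAt (E →L[ℝ] ℝ) (fun x : M => Fiber E x) p.1 q).2) p
      (ContinuousLinearMap.snd ℝ E (E →L[ℝ] ℝ)) := by
    have key : ∀ y ∈ (extChartAt (model E) p).target,
        (trivializationAt (E →L[ℝ] ℝ) (fun x : M => Fiber E x) p.1
          ((extChartAt (model E) p).symm y)).2 = y.2 := by
      intro y hy
      have e : ∀ q : Total E M, (extChartAt (model E) p q).2
          = (trivializationAt (E →L[ℝ] ℝ) (fun x : M => Fiber E x) p.1 q).2 := by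
        intro q
        rw [FiberBundle.extChartAt]
        rfl
      rw [← e, (extChartAt (model E) p).right_inv hy]
    refine ⟨((trivializationAt (E →L[ℝ] ℝ) (fun x : M => Fiber E x) p.1).continuousAt
        FiberBundle.mem_trivializationAt_proj_source).snd,
      (hasFDerivAt_snd.hasFDerivWithinAt).congr_of_eventuallyEq ?_
        (key _ (mem_extChartAt_target p))⟩
    filter_upwards [extChartAt_target_mem_nhdsWithin p] with y hy using key y hy
  exact h.mfderiv

end Charts

/-! ### Overlaps of charts of the base. -/

section CoordChangeDomain

variable {E : Type*} [NormedAddCommGroup E] [NormedSpace ℝ E]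
  {M : Type*} [TopologicalSpace M] [ChartedSpace E M]

theorem coordChange_domain_mem_nhds (x x' : M) {z : E}
    (hz : z ∈ (extChartAt 𝓘(ℝ, E) x).target)
    (hz' : (extChartAt 𝓘(ℝ, E) x).symm z ∈ (extChartAt 𝓘(ℝ, E) x').source) :
    ∀ᶠ w in nhds z, w ∈ (extChartAt 𝓘(ℝ, E) x).target ∧
      (extChartAt 𝓘(ℝ, E) x).symm w ∈ (extChartAt 𝓘(ℝ, E) x').source :=
  Filter.Eventually.and ((isOpen_extChartAt_target x).mem_nhds hz)
    ((continuousAt_extChartAt_symm'' hz).eventually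
      ((isOpen_extChartAt_source x').mem_nhds hz'))

end CoordChangeDomain

/-! ### Components of the metric and their coordinate changes. -/

section MetricComponents

variable {E : Type*} [NormedAddCommGroup E] [NormedSpace ℝ E]
  {M : Type*} [TopologicalSpace M] [ChartedSpace E M] [IsManifold 𝓘(ℝ, E) ∞ M]

/-- The differential of the inverse of the distinguished chart at `x`. -/
def chartSymmDeriv (x : M) (z : E) : E →L[ℝ] E :=
  mfderiv 𝓘(ℝ, E) 𝓘(ℝ, E) (extChartAt 𝓘(ℝ, E) x).symm z

theorem chartSymmDeriv_self (x : M) :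
    chartSymmDeriv x (extChartAt 𝓘(ℝ, E) x x) = ContinuousLinearMap.id ℝ E :=
  mfderiv_extChartAt_symm_self x

theorem chartSymmDeriv_isInvertible (x : M) {z : E} (hz : z ∈ (extChartAt 𝓘(ℝ, E) x).target) :
    (chartSymmDeriv x z).IsInvertible := by
  have : IsManifold 𝓘(ℝ, E) 1 M := IsManifold.of_le (n := ∞) (by simp)
  have h := isInvertible_mfderivWithin_extChartAt_symm (I := 𝓘(ℝ, E)) hz
  rw [modelWithCornersSelf_coe, range_id, mfderivWithin_univ] at h
  exact h

theorem metricInChart_apply (g : Metric E M) (x : M) (z v w : E) :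
    metricInChart g x z v w = flat g ((extChartAt 𝓘(ℝ, E) x).symm z)
      (chartSymmDeriv x z v) (chartSymmDeriv x z w) := rfl

theorem isInner_flat (g : Metric E M) (x : M) : IsInner (flat g x) :=
  ⟨g.symm x, g.pos x⟩

theorem metricInChart_self (g : Metric E M) (x : M) :
    metricInChart g x (extChartAt 𝓘(ℝ, E) x x) = flat g x := by
  ext v w
  rw [metricInChart_apply, chartSymmDeriv_self, extChartAt_to_inv]
  rfl

theorem isInner_metricInChart (g : Metric E M) (x : M) {z : E}
    (hz : z ∈ (extChartAt 𝓘(ℝ, E) x).target) : IsInner (metricInChart g x z) := by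
  obtain ⟨e, he⟩ := chartSymmDeriv_isInvertible x hz
  refine ⟨fun v w => ?_, fun v hv => ?_⟩
  · rw [metricInChart_apply, metricInChart_apply, (isInner_flat g _).symm]
  · rw [metricInChart_apply]
    refine (isInner_flat g _).pos _ ?_
    rw [← he]
    simpa using hv

/-- Smoothness of g as a section is smoothness in the trivialization of the bundle of bilinear
forms. That trivialization pulls back by the inverse tangent trivialization, which is the
differential of the inverse chart. -/
theorem contDiffOn_metricInChart [FiniteDimensional ℝ E] (g : Metric E M) (x : M) :
    ContDiffOn ℝ ∞ (metricInChart g x) (extChartAt 𝓘(ℝ, E) x).target := by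
  have h1M : IsManifold 𝓘(ℝ, E) 1 M := IsManifold.of_le (n := ∞) (by simp)
  have h1 := (g.contMDiff.contMDiffOn (s := (chartAt E x).source))
  rw [Trivialization.contMDiffOn_section_iff (trivializationAt (E →L[ℝ] E →L[ℝ] ℝ)
    (fun b : M => TangentSpace 𝓘(ℝ, E) b →L[ℝ] TangentSpace 𝓘(ℝ, E) b →L[ℝ] Trivial M ℝ b) x)
    (chartAt E x).open_source (by simp)] at h1
  have h2 := h1.comp (contMDiffOn_extChartAt_symm (I := 𝓘(ℝ, E)) (n := ∞) x) (fun z hz => by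
    have := (extChartAt 𝓘(ℝ, E) x).map_target hz
    rwa [extChartAt_source] at this)
  refine h2.contDiffOn.congr (fun z hz => ?_)
  have hx : (extChartAt 𝓘(ℝ, E) x).symm z ∈ (chartAt E x).source := by
    have := (extChartAt 𝓘(ℝ, E) x).map_target hz
    rwa [extChartAt_source] at this
  have h := TangentBundle.symmL_trivializationAt (I := 𝓘(ℝ, E)) (𝕜 := ℝ) hx
  rw [modelWithCornersSelf_coe, range_id, mfderivWithin_univ,
    (extChartAt 𝓘(ℝ, E) x).right_inv hz] at h
  ext v w
  refine Eq.trans ?_ (inCoordinates_apply_eq₂ (F₁ := E) (E₁ := TangentSpace 𝓘(ℝ, E)) (F₂ := E)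
    (E₂ := TangentSpace 𝓘(ℝ, E)) (F₃ := ℝ) (E₃ := Trivial M ℝ) (x₀ := x)
    (ϕ := g.inner ((extChartAt 𝓘(ℝ, E) x).symm z)) (v := v) (w := w)
    (by simpa using hx) (by simpa using hx) (by simp)).symm
  have h' : ∀ u, (trivializationAt E (TangentSpace 𝓘(ℝ, E)) x).symm
      ((extChartAt 𝓘(ℝ, E) x).symm z) u = chartSymmDeriv x z u := fun u => by
    rw [← Trivialization.symmL_apply (R := ℝ) _ (by simpa using hx), h]
    rfl
  rw [h', h', metricInChart_apply]
  simp
  rfl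

theorem contDiffAt_coordChange (x x' : M) {z : E} (hz : z ∈ (extChartAt 𝓘(ℝ, E) x).target)
    (hz' : (extChartAt 𝓘(ℝ, E) x).symm z ∈ (extChartAt 𝓘(ℝ, E) x').source) :
    ContDiffAt ℝ ∞ (extChartAt 𝓘(ℝ, E) x' ∘ (extChartAt 𝓘(ℝ, E) x).symm) z := by
  have h := contDiffWithinAt_ext_coord_change (I := 𝓘(ℝ, E)) (n := ∞) x' x (y := z)
    ⟨hz, hz'⟩
  rwa [modelWithCornersSelf_coe, range_id, contDiffWithinAt_univ] at h

/-- The chain rule for the differentials of the inverse charts. -/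
theorem chartSymmDeriv_coordChange (x x' : M) {z : E} (hz : z ∈ (extChartAt 𝓘(ℝ, E) x).target)
    (hz' : (extChartAt 𝓘(ℝ, E) x).symm z ∈ (extChartAt 𝓘(ℝ, E) x').source) (v : E) :
    chartSymmDeriv x z v
      = chartSymmDeriv x' (extChartAt 𝓘(ℝ, E) x' ((extChartAt 𝓘(ℝ, E) x).symm z))
        (fderiv ℝ (extChartAt 𝓘(ℝ, E) x' ∘ (extChartAt 𝓘(ℝ, E) x).symm) z v) := by
  have h1M : IsManifold 𝓘(ℝ, E) 1 M := IsManifold.of_le (n := ∞) (by simp)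
  set τ := extChartAt 𝓘(ℝ, E) x' ∘ (extChartAt 𝓘(ℝ, E) x).symm
  have hτz : τ z ∈ (extChartAt 𝓘(ℝ, E) x').target := (extChartAt 𝓘(ℝ, E) x').map_source hz'
  have hτ : MDifferentiableAt 𝓘(ℝ, E) 𝓘(ℝ, E) τ z :=
    ((contDiffAt_coordChange x x' hz hz').differentiableAt (by simp)).mdifferentiableAt
  have hs := mdifferentiableWithinAt_extChartAt_symm (I := 𝓘(ℝ, E)) hτz
  rw [modelWithCornersSelf_coe, range_id, mdifferentiableWithinAt_univ] at hs
  have hev : (extChartAt 𝓘(ℝ, E) x).symm =ᶠ[nhds z] (extChartAt 𝓘(ℝ, E) x').symm ∘ τ := by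
    filter_upwards [coordChange_domain_mem_nhds x x' hz hz'] with w hw
    exact ((extChartAt 𝓘(ℝ, E) x').left_inv hw.2).symm
  have h := hev.mfderiv_eq (I := 𝓘(ℝ, E)) (I' := 𝓘(ℝ, E))
  rw [mfderiv_comp z hs hτ, mfderiv_eq_fderiv] at h
  exact congrArg (fun f : E →L[ℝ] E => f v) h

end MetricComponents

/-! ### From the chart centred at each point to a fixed chart. -/

section Tensors

variable {E : Type*} [NormedAddCommGroup E] [NormedSpace ℝ E]
  {M : Type*} [TopologicalSpace M] [ChartedSpace E M] [IsManifold 𝓘(ℝ, E) ∞ M]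
  (g : Metric E M)

theorem complexStructure_eq (q : Total E M) (a₁ a₂ b₁ b₂ : ℝ → ℝ) :
    complexStructure g q a₁ a₂ b₁ b₂ = endoOf (flat g q.1) (covector q) (christoffelZero g q)
      (a₁ (energy g q)) (a₂ (energy g q)) (b₁ (energy g q)) (b₂ (energy g q)) := by
  unfold complexStructure absDiff
  rw [projDeriv_eq, fiberCoordDeriv_eq]
  rfl

theorem liftedMetric_eq (q : Total E M) (c₁ c₂ d₁ d₂ : ℝ → ℝ) :
    liftedMetric g q c₁ c₂ d₁ d₂ = bilinOf (flat g q.1) (covector q) (christoffelZero g q)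
      (c₁ (energy g q)) (c₂ (energy g q)) (d₁ (energy g q)) (d₂ (energy g q)) := by
  unfold liftedMetric absDiff
  rw [projDeriv_eq, fiberCoordDeriv_eq]
  rfl

theorem energy_eq (q : Total E M) : energy g q = energyOf (flat g q.1) (covector q) := rfl

theorem christoffelZero_eq (q : Total E M) :
    christoffelZero g q = localChristoffel (metricInChart g q.1)
      (extChartAt 𝓘(ℝ, E) q.1 q.1, covector q) := by
  rw [localChristoffel, metricInChart_self]
  rfl

theorem extChartAt_self_eq (q : Total E M) :
    extChartAt (model E) q q = (extChartAt 𝓘(ℝ, E) q.1 q.1, covector q) := by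
  refine Prod.ext (extChartAt_apply_fst q q) ?_
  ext v
  rw [extChartAt_apply_snd q q (mem_extChartAt_source _), mfderiv_extChartAt_symm_self]
  rfl

/-- The differential of the inverse of the distinguished chart of `T*M` at `p₀`. -/
def totalChartSymmDeriv (p₀ : Total E M) (y : E × (E →L[ℝ] ℝ)) :
    E × (E →L[ℝ] ℝ) →L[ℝ] E × (E →L[ℝ] ℝ) :=
  mfderiv 𝓘(ℝ, E × (E →L[ℝ] ℝ)) (model E) (extChartAt (model E) p₀).symm y

variable [FiniteDimensional ℝ E]

/-- At q the tensors are built from the chart centred at q. The transition from the chart at p₀ to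
that chart is an induced coordinate change, so `isTransported_of_coordChange` compares the two sets
of data. -/
theorem exists_isTransported (p₀ : Total E M) {y : E × (E →L[ℝ] ℝ)}
    (hy : y ∈ (extChartAt (model E) p₀).target) :
    ∃ L : E ≃L[ℝ] E, IsTransported L (totalChartSymmDeriv p₀ y)
      (metricInChart g p₀.1 y.1) (flat g ((extChartAt (model E) p₀).symm y).1)
      y.2 (covector ((extChartAt (model E) p₀).symm y))
      (localChristoffel (metricInChart g p₀.1) y)
      (christoffelZero g ((extChartAt (model E) p₀).symm y)) := by
  set q := (extChartAt (model E) p₀).symm y with hq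
  have hy' := hy
  rw [extChartAt_target_eq] at hy'
  have hy1 := hy'.1
  have hq1 : q.1 = (extChartAt 𝓘(ℝ, E) p₀.1).symm y.1 := extChartAt_symm_proj p₀ hy
  have hq1s : (extChartAt 𝓘(ℝ, E) p₀.1).symm y.1 ∈ (extChartAt 𝓘(ℝ, E) q.1).source := by
    rw [← hq1]
    exact mem_extChartAt_source _
  set τ := extChartAt 𝓘(ℝ, E) q.1 ∘ (extChartAt 𝓘(ℝ, E) p₀.1).symm with hτ
  -- The differential of the inverse chart centred at π(q) is the identity at its centre, so the
  -- chain rule leaves only the differential of the inverse chart at π(p₀).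
  have hτL : fderiv ℝ τ y.1 = chartSymmDeriv p₀.1 y.1 := by
    ext v
    rw [chartSymmDeriv_coordChange p₀.1 q.1 hy1 hq1s, ← hq1, chartSymmDeriv_self]
    rfl
  obtain ⟨L, hL⟩ := chartSymmDeriv_isInvertible p₀.1 hy1
  refine ⟨L, ?_⟩
  set Ψ : E × (E →L[ℝ] ℝ) → E × (E →L[ℝ] ℝ) :=
    extChartAt (model E) q ∘ (extChartAt (model E) p₀).symm with hΨ
  have hΨy : Ψ y = (extChartAt 𝓘(ℝ, E) q.1 q.1, covector q) := extChartAt_self_eq q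
  have hO : IsOpen (extChartAt (model E) p₀).target := isOpen_extChartAt_target p₀
  have hev : ∀ᶠ z in nhds y, z ∈ (extChartAt (model E) p₀).target ∧
      (extChartAt 𝓘(ℝ, E) p₀.1).symm z.1 ∈ (extChartAt 𝓘(ℝ, E) q.1).source := by
    filter_upwards [hO.mem_nhds hy,
      continuousAt_fst.eventually (coordChange_domain_mem_nhds p₀.1 q.1 hy1 hq1s)] with z h1 h2
    exact ⟨h1, h2.2⟩
  have hΨ₁ : ∀ z ∈ (extChartAt (model E) p₀).target, (Ψ z).1 = τ z.1 := by
    intro z hz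
    rw [hΨ, Function.comp_apply, extChartAt_apply_fst, extChartAt_symm_proj p₀ hz]
    rfl
  -- The manifold derivative of the inverse chart is computed in the chart centred at its value q,
  -- which is exactly the derivative of the transition map.
  have hA : HasFDerivAt Ψ (totalChartSymmDeriv p₀ y) y := by
    have : IsManifold (model E) 1 (Total E M) := IsManifold.of_le (n := ∞) (by simp)
    have hd := (mdifferentiableWithinAt_extChartAt_symm (I := model E) hy)
    rw [ModelWithCorners.range_eq_univ, mdifferentiableWithinAt_univ] at hd
    have h := hd.hasMFDerivAt.2
    rw [modelWithCornersSelf_coe, range_id] at h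
    have h' : HasFDerivWithinAt Ψ (totalChartSymmDeriv p₀ y) univ y := h
    exact hasFDerivWithinAt_univ.1 h'
  have hkey := isTransported_of_coordChange (h := metricInChart g p₀.1)
    (h' := metricInChart g q.1) (τ := τ) (Ψ := Ψ) (y := y) (L := L)
    (A := totalChartSymmDeriv p₀ y) (contDiffAt_coordChange p₀.1 q.1 hy1 hq1s)
    (hτL.trans hL.symm)
    (((contDiffOn_metricInChart g p₀.1).contDiffAt
      ((isOpen_extChartAt_target p₀.1).mem_nhds hy1)).differentiableAt (by simp))
    (((contDiffOn_metricInChart g q.1).contDiffAt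
      ((isOpen_extChartAt_target q.1).mem_nhds (by
        rw [hΨy]; exact mem_extChartAt_target q.1))).differentiableAt (by simp))
    (by
      filter_upwards [coordChange_domain_mem_nhds p₀.1 q.1 hy1 hq1s] with z hz v w
      rw [metricInChart_apply, metricInChart_apply, chartSymmDeriv_coordChange p₀.1 q.1 hz.1 hz.2,
        chartSymmDeriv_coordChange p₀.1 q.1 hz.1 hz.2]
      rw [hτ, Function.comp_apply, (extChartAt 𝓘(ℝ, E) q.1).left_inv hz.2])
    hA (hev.mono fun z hz => hΨ₁ z hz.1)
    (by
      filter_upwards [hev] with z hz v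
      have hz1 : z ∈ (extChartAt 𝓘(ℝ, E) p₀.1).target ×ˢ univ := extChartAt_target_eq p₀ ▸ hz.1
      set r := (extChartAt (model E) p₀).symm z with hr
      have hr1 : r.1 = (extChartAt 𝓘(ℝ, E) p₀.1).symm z.1 := extChartAt_symm_proj p₀ hz.1
      have e1 : z.2 v = covector r (chartSymmDeriv p₀.1 z.1 v) := by
        have h := extChartAt_apply_snd p₀ r (by
          rw [hr1]; exact (extChartAt 𝓘(ℝ, E) p₀.1).map_target hz1.1) v
        rw [hr, (extChartAt (model E) p₀).right_inv hz.1, ← hr, hr1,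
          (extChartAt 𝓘(ℝ, E) p₀.1).right_inv hz1.1] at h
        exact h
      have e2 : ∀ u, (Ψ z).2 u = covector r (chartSymmDeriv q.1 (τ z.1) u) := by
        intro u
        have h := extChartAt_apply_snd q r (by rw [hr1]; exact hz.2) u
        rw [hr1] at h
        exact h
      rw [e1, e2, chartSymmDeriv_coordChange p₀.1 q.1 hz1.1 hz.2]
      rfl)
    (isInner_metricInChart g p₀.1 hy1)
    (isInner_metricInChart g q.1 (by rw [hΨy]; exact mem_extChartAt_target q.1))
  rw [christoffelZero_eq]
  rw [hΨy] at hkey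
  rw [← metricInChart_self]
  exact hkey

end Tensors

end Cotangent

/-! ### The fundamental form in a chart of any manifold. -/

namespace DiffForm

variable {V : Type*} [NormedAddCommGroup V] [NormedSpace ℝ V]
  {H : Type*} [TopologicalSpace H] {I : ModelWithCorners ℝ V H} [I.Boundaryless]
  {N : Type*} [TopologicalSpace N] [ChartedSpace H N] [IsManifold I 1 N]

/-- Between G and J, the differentials of the chart and of its inverse compose to the identity. -/
theorem inChart_fundamentalForm_apply
    {G : ∀ p : N, TangentSpace I p →L[ℝ] TangentSpace I p →L[ℝ] ℝ}
    {J : ∀ p : N, TangentSpace I p →L[ℝ] TangentSpace I p} (h : IsAlmostHermitian G J)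
    (p₀ : N) {y : V} (hy : y ∈ (extChartAt I p₀).target) (v : Fin 2 → V) :
    inChart (fundamentalForm h) p₀ y v
      = bilinInChart G p₀ y (v 0) (endoInChart J p₀ y (v 1)) := by
  have hA := mfderivWithin_extChartAt_symm_comp_mfderiv_extChartAt hy
  rw [ModelWithCorners.range_eq_univ, mfderivWithin_univ] at hA
  have h1 := congrArg (fun f : TangentSpace I ((extChartAt I p₀).symm y) →L[ℝ]
    TangentSpace I ((extChartAt I p₀).symm y) => f (J ((extChartAt I p₀).symm y)
      (mfderiv 𝓘(ℝ, V) I (extChartAt I p₀).symm y (v 1)))) hA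
  exact congrArg (fun w => G ((extChartAt I p₀).symm y)
    (mfderiv 𝓘(ℝ, V) I (extChartAt I p₀).symm y (v 0)) w) h1.symm

end DiffForm

/-! ### The local form of φ and its exterior derivative. -/

namespace Cotangent

/-- The bilinear form `((X, θ), (Y, η)) ↦ θ(Y)`, so that `y ↦ liouville y` is the canonical `1`-form
in the coordinates on `T*M`. -/
def liouville (E : Type*) [NormedAddCommGroup E] [NormedSpace ℝ E] :
    E × (E →L[ℝ] ℝ) →L[ℝ] E × (E →L[ℝ] ℝ) →L[ℝ] ℝ :=
  ((ContinuousLinearMap.compL ℝ (E × (E →L[ℝ] ℝ)) E ℝ).flip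
    (ContinuousLinearMap.fst ℝ E (E →L[ℝ] ℝ))) ∘L ContinuousLinearMap.snd ℝ E (E →L[ℝ] ℝ)

@[simp] theorem liouville_apply {E : Type*} [NormedAddCommGroup E] [NormedSpace ℝ E]
    (v w : E × (E →L[ℝ] ℝ)) : liouville E v w = v.2 w.1 := rfl

section LocalExpressions

variable {E : Type*} [NormedAddCommGroup E] [NormedSpace ℝ E] [FiniteDimensional ℝ E]
  {M : Type*} [TopologicalSpace M] [ChartedSpace E M] [IsManifold 𝓘(ℝ, E) ∞ M]
  (g : Metric E M)

theorem energy_extChartAt_symm (p₀ : Total E M) {y : E × (E →L[ℝ] ℝ)}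
    (hy : y ∈ (extChartAt (model E) p₀).target) :
    energy g ((extChartAt (model E) p₀).symm y) = localEnergy (metricInChart g p₀.1) y := by
  obtain ⟨L, hT⟩ := exists_isTransported g p₀ hy
  exact hT.energyOf_eq (isInner_metricInChart g p₀.1 (fst_mem_target p₀ hy)) (isInner_flat g _)

theorem bilinInChart_natG (c₁ c₂ d₁ d₂ : ℝ → ℝ) (p₀ : Total E M) {y : E × (E →L[ℝ] ℝ)}
    (hy : y ∈ (extChartAt (model E) p₀).target) :
    DiffForm.bilinInChart (natG g c₁ c₂ d₁ d₂) p₀ y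
      = bilinOf (metricInChart g p₀.1 y.1) y.2 (localChristoffel (metricInChart g p₀.1) y)
        (c₁ (localEnergy (metricInChart g p₀.1) y)) (c₂ (localEnergy (metricInChart g p₀.1) y))
        (d₁ (localEnergy (metricInChart g p₀.1) y))
        (d₂ (localEnergy (metricInChart g p₀.1) y)) := by
  obtain ⟨L, hT⟩ := exists_isTransported g p₀ hy
  refine ContinuousLinearMap.ext fun v => ContinuousLinearMap.ext fun w => ?_
  change liftedMetric g ((extChartAt (model E) p₀).symm y) c₁ c₂ d₁ d₂
    (totalChartSymmDeriv p₀ y v) (totalChartSymmDeriv p₀ y w) = _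
  rw [liftedMetric_eq, energy_extChartAt_symm g p₀ hy,
    hT.bilinOf_eq (isInner_metricInChart g p₀.1 (fst_mem_target p₀ hy)) (isInner_flat g _)]

theorem complexStructure_totalChartSymmDeriv (a₁ a₂ b₁ b₂ : ℝ → ℝ) (p₀ : Total E M)
    {y : E × (E →L[ℝ] ℝ)} (hy : y ∈ (extChartAt (model E) p₀).target)
    (w : E × (E →L[ℝ] ℝ)) :
    complexStructure g ((extChartAt (model E) p₀).symm y) a₁ a₂ b₁ b₂
        (totalChartSymmDeriv p₀ y w)
      = totalChartSymmDeriv p₀ y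
        (endoOf (metricInChart g p₀.1 y.1) y.2 (localChristoffel (metricInChart g p₀.1) y)
        (a₁ (localEnergy (metricInChart g p₀.1) y)) (a₂ (localEnergy (metricInChart g p₀.1) y))
        (b₁ (localEnergy (metricInChart g p₀.1) y))
        (b₂ (localEnergy (metricInChart g p₀.1) y)) w) := by
  obtain ⟨L, hT⟩ := exists_isTransported g p₀ hy
  rw [complexStructure_eq, energy_extChartAt_symm g p₀ hy,
    hT.endoOf_eq (isInner_metricInChart g p₀.1 (fst_mem_target p₀ hy)) (isInner_flat g _)]

theorem endoInChart_natJ (a₁ a₂ b₁ b₂ : ℝ → ℝ) (p₀ : Total E M) {y : E × (E →L[ℝ] ℝ)}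
    (hy : y ∈ (extChartAt (model E) p₀).target) :
    DiffForm.endoInChart (natJ g a₁ a₂ b₁ b₂) p₀ y
      = endoOf (metricInChart g p₀.1 y.1) y.2 (localChristoffel (metricInChart g p₀.1) y)
        (a₁ (localEnergy (metricInChart g p₀.1) y)) (a₂ (localEnergy (metricInChart g p₀.1) y))
        (b₁ (localEnergy (metricInChart g p₀.1) y))
        (b₂ (localEnergy (metricInChart g p₀.1) y)) := by
  have : IsManifold (model E) 1 (Total E M) := IsManifold.of_le (n := ∞) (by simp)
  have hB := mfderiv_extChartAt_comp_mfderivWithin_extChartAt_symm (I := model E) hy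
  rw [ModelWithCorners.range_eq_univ, mfderivWithin_univ] at hB
  refine ContinuousLinearMap.ext fun w => ?_
  change (mfderiv (model E) 𝓘(ℝ, E × (E →L[ℝ] ℝ)) (extChartAt (model E) p₀)
    ((extChartAt (model E) p₀).symm y) : E × (E →L[ℝ] ℝ) →L[ℝ] E × (E →L[ℝ] ℝ))
    (complexStructure g ((extChartAt (model E) p₀).symm y) a₁ a₂ b₁ b₂
    (totalChartSymmDeriv p₀ y w)) = _
  rw [complexStructure_totalChartSymmDeriv g _ _ _ _ p₀ hy]
  exact congrArg (fun f : E × (E →L[ℝ] ℝ) →L[ℝ] E × (E →L[ℝ] ℝ) => f (endoOf _ _ _ _ _ _ _ w)) hB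

/-- The fundamental form in coordinates, `λ(t) dα + μ(t) dt ∧ α`, with `α` the canonical
`1`-form. -/
def localForm (h : E → E →L[ℝ] E →L[ℝ] ℝ) (lam mu : ℝ → ℝ) (y : E × (E →L[ℝ] ℝ)) :
    (E × (E →L[ℝ] ℝ)) [⋀^Fin 2]→L[ℝ] ℝ :=
  antisymm _ (lam (localEnergy h y) • liouville E
    + mu (localEnergy h y) • (fderiv ℝ (localEnergy h) y).smulRight (liouville E y))

/-- In `bilinOf_endoOf_vertical` the factor of λ loses its Christoffel terms by symmetry and becomes
dα; the factor of μ is dt ∧ α by `fderiv_localEnergy`. -/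
theorem inChart_fundamentalForm {a₁ a₂ b₁ b₂ c₁ c₂ d₁ d₂ lam mu : ℝ → ℝ}
    (had : ∀ t, 0 ≤ t →
      IsAdapted t (a₁ t) (a₂ t) (b₁ t) (b₂ t) (c₁ t) (c₂ t) (d₁ t) (d₂ t) (lam t) (mu t))
    (H : DiffForm.IsAlmostHermitian (natG g c₁ c₂ d₁ d₂) (natJ g a₁ a₂ b₁ b₂))
    (p₀ : Total E M) {y : E × (E →L[ℝ] ℝ)} (hy : y ∈ (extChartAt (model E) p₀).target) :
    DiffForm.inChart (DiffForm.fundamentalForm H) p₀ y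
      = localForm (metricInChart g p₀.1) lam mu y := by
  set h := metricInChart g p₀.1
  have hy1 := fst_mem_target p₀ hy
  have hU : IsOpen (extChartAt 𝓘(ℝ, E) p₀.1).target := isOpen_extChartAt_target p₀.1
  have hh : ContDiffOn ℝ ∞ h (extChartAt 𝓘(ℝ, E) p₀.1).target := contDiffOn_metricInChart g p₀.1
  have hi : ∀ x ∈ (extChartAt 𝓘(ℝ, E) p₀.1).target, IsInner (h x) := fun x hx =>
    isInner_metricInChart g p₀.1 hx
  refine ContinuousAlternatingMap.ext fun v => ?_
  have : IsManifold (model E) 1 (Total E M) := IsManifold.of_le (n := ∞) (by simp)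
  rw [DiffForm.inChart_fundamentalForm_apply H p₀ hy, bilinInChart_natG g _ _ _ _ p₀ hy,
    endoInChart_natJ g _ _ _ _ p₀ hy]
  have hy' : y ∈ (extChartAt 𝓘(ℝ, E) p₀.1).target ×ˢ (univ : Set (E →L[ℝ] ℝ)) := ⟨hy1, trivial⟩
  have had' := had _ (localEnergy_nonneg hi hy')
  refine (bilinOf_endoOf_vertical (hi _ hy1) had' (v 0) (v 1)).trans ?_
  rw [localForm, antisymm_apply]
  simp only [add_apply, smul_apply, ContinuousLinearMap.smulRight_apply, liouville_apply,
    smul_eq_mul, fderiv_localEnergy hU hh hi hy', sub_apply]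
  rw [localChristoffel_symm hU hh hi hy1 (v 0).1 (v 1).1]
  ring

theorem extDeriv_localForm {h : E → E →L[ℝ] E →L[ℝ] ℝ} {U : Set E} (hU : IsOpen U)
    (hh : ContDiffOn ℝ ∞ h U) (hi : ∀ x ∈ U, IsInner (h x)) {lam mu : ℝ → ℝ}
    {y : E × (E →L[ℝ] ℝ)} (hy : y.1 ∈ U) {l' : ℝ}
    (hl : HasDerivWithinAt lam l' (Ici 0) (localEnergy h y))
    (hm : DifferentiableWithinAt ℝ mu (Ici 0) (localEnergy h y))
    (v : Fin 3 → E × (E →L[ℝ] ℝ)) :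
    extDeriv (localForm h lam mu) y v = (l' - mu (localEnergy h y)) *
      (fderiv ℝ (localEnergy h) y (v 0) * ((v 1).2 (v 2).1 - (v 2).2 (v 1).1)
      - fderiv ℝ (localEnergy h) y (v 1) * ((v 0).2 (v 2).1 - (v 2).2 (v 0).1)
      + fderiv ℝ (localEnergy h) y (v 2) * ((v 0).2 (v 1).1 - (v 1).2 (v 0).1)) := by
  have hn : U ×ˢ (univ : Set (E →L[ℝ] ℝ)) ∈ nhds y :=
    (hU.prod isOpen_univ).mem_nhds ⟨hy, trivial⟩
  exact extDeriv_antisymm (liouville E) ((contDiffOn_localEnergy hh hi).contDiffAt hn)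
    (Filter.mem_of_superset hn fun z hz => localEnergy_nonneg hi hz) hl hm v

theorem contDiffOn_localForm {h : E → E →L[ℝ] E →L[ℝ] ℝ} {U : Set E} (hU : IsOpen U)
    (hh : ContDiffOn ℝ ∞ h U) (hi : ∀ x ∈ U, IsInner (h x)) {lam mu : ℝ → ℝ}
    (hlam : ContDiffOn ℝ ∞ lam (Ici 0)) (hmu : ContDiffOn ℝ ∞ mu (Ici 0)) :
    ContDiffOn ℝ ∞ (localForm h lam mu) (U ×ˢ univ) := by
  have hT := contDiffOn_localEnergy hh hi
  have hmaps : MapsTo (localEnergy h) (U ×ˢ univ) (Ici 0) := fun z hz => localEnergy_nonneg hi hz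
  have hdT : ContDiffOn ℝ ∞ (fderiv ℝ (localEnergy h)) (U ×ˢ univ) :=
    hT.fderiv_of_isOpen (hU.prod isOpen_univ) (by simp)
  exact (antisymm (E × (E →L[ℝ] ℝ))).contDiff.comp_contDiffOn
    (((hlam.comp hT hmaps).smul contDiffOn_const).add
      ((hmu.comp hT hmaps).smul (hdT.smulRight (liouville E).contDiff.contDiffOn)))

/-- Only smoothness needs the expressions in a fixed chart; the other axioms are linear algebra at
each point. -/
theorem isAlmostHermitian_nat {a₁ a₂ b₁ b₂ c₁ c₂ d₁ d₂ lam mu : ℝ → ℝ}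
    (ha₁ : ContDiffOn ℝ ∞ a₁ (Ici 0)) (ha₂ : ContDiffOn ℝ ∞ a₂ (Ici 0))
    (hb₁ : ContDiffOn ℝ ∞ b₁ (Ici 0)) (hb₂ : ContDiffOn ℝ ∞ b₂ (Ici 0))
    (hc₁ : ContDiffOn ℝ ∞ c₁ (Ici 0)) (hc₂ : ContDiffOn ℝ ∞ c₂ (Ici 0))
    (hd₁ : ContDiffOn ℝ ∞ d₁ (Ici 0)) (hd₂ : ContDiffOn ℝ ∞ d₂ (Ici 0))
    (had : ∀ t, 0 ≤ t →
      IsAdapted t (a₁ t) (a₂ t) (b₁ t) (b₂ t) (c₁ t) (c₂ t) (d₁ t) (d₂ t) (lam t) (mu t)) :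
    DiffForm.IsAlmostHermitian (natG g c₁ c₂ d₁ d₂) (natJ g a₁ a₂ b₁ b₂) := by
  have had' : ∀ p : Total E M, IsAdapted (energyOf (flat g p.1) (covector p)) _ _ _ _ _ _ _ _ _ _ :=
    fun p => had (energy g p) (mul_nonneg (by norm_num)
      ((isInner_flat g p.1).inverse_nonneg (covector p)))
  have hcomp : ∀ (p₀ : Total E M) {f : ℝ → ℝ}, ContDiffOn ℝ ∞ f (Ici 0) →
      ContDiffOn ℝ ∞ (fun y => f (localEnergy (metricInChart g p₀.1) y))
        ((extChartAt 𝓘(ℝ, E) p₀.1).target ×ˢ univ) := fun p₀ f hf =>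
    hf.comp (contDiffOn_localEnergy (contDiffOn_metricInChart g p₀.1)
      (fun x hx => isInner_metricInChart g p₀.1 hx))
      (fun z hz => localEnergy_nonneg (fun x hx => isInner_metricInChart g p₀.1 hx) hz)
  refine ⟨fun p₀ => ?_, fun p₀ => ?_, fun p X => ?_, fun p X Y => ?_, fun p X hX => ?_,
    fun p X Y => ?_⟩
  · refine ContDiffOn.congr ?_ (fun y hy => bilinInChart_natG g c₁ c₂ d₁ d₂ p₀ hy)
    rw [extChartAt_target_eq]
    exact contDiffOn_bilinOf (isOpen_extChartAt_target p₀.1) (contDiffOn_metricInChart g p₀.1)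
      (fun x hx => isInner_metricInChart g p₀.1 hx) (hcomp p₀ hc₁) (hcomp p₀ hc₂) (hcomp p₀ hd₁)
      (hcomp p₀ hd₂)
  · refine ContDiffOn.congr ?_ (fun y hy => endoInChart_natJ g a₁ a₂ b₁ b₂ p₀ hy)
    rw [extChartAt_target_eq]
    exact contDiffOn_endoOf (isOpen_extChartAt_target p₀.1) (contDiffOn_metricInChart g p₀.1)
      (fun x hx => isInner_metricInChart g p₀.1 hx) (hcomp p₀ ha₁) (hcomp p₀ ha₂) (hcomp p₀ hb₁)
      (hcomp p₀ hb₂)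
  · unfold natJ
    rw [complexStructure_eq]
    exact endoOf_endoOf (isInner_flat g p.1) (had' p) X
  · unfold natG
    rw [liftedMetric_eq]
    exact bilinOf_symm (isInner_flat g p.1) X Y
  · unfold natG
    rw [liftedMetric_eq]
    exact bilinOf_pos (isInner_flat g p.1) (had' p) hX
  · unfold natG natJ
    rw [liftedMetric_eq, complexStructure_eq]
    exact bilinOf_endoOf_endoOf (isInner_flat g p.1) (had' p) X Y

theorem isClosedForm_fundamentalForm {a₁ a₂ b₁ b₂ c₁ c₂ d₁ d₂ lam mu : ℝ → ℝ}
    (hlam : ContDiffOn ℝ ∞ lam (Ici 0)) (hmu : ContDiffOn ℝ ∞ mu (Ici 0))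
    (had : ∀ t, 0 ≤ t →
      IsAdapted t (a₁ t) (a₂ t) (b₁ t) (b₂ t) (c₁ t) (c₂ t) (d₁ t) (d₂ t) (lam t) (mu t))
    (H : DiffForm.IsAlmostHermitian (natG g c₁ c₂ d₁ d₂) (natJ g a₁ a₂ b₁ b₂))
    (hderiv : ∀ t, 0 ≤ t → HasDerivWithinAt lam (mu t) (Ici 0) t) :
    DiffForm.IsClosedForm (DiffForm.fundamentalForm H) := by
  intro p₀
  have hU : IsOpen (extChartAt 𝓘(ℝ, E) p₀.1).target := isOpen_extChartAt_target p₀.1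
  have hh := contDiffOn_metricInChart g p₀.1
  have hi : ∀ x ∈ (extChartAt 𝓘(ℝ, E) p₀.1).target, IsInner (metricInChart g p₀.1 x) :=
    fun x hx => isInner_metricInChart g p₀.1 hx
  have heq := fun y hy => inChart_fundamentalForm g had H p₀ (y := y) hy
  refine ⟨ContDiffOn.congr ?_ heq, fun y hy => ?_⟩
  · rw [extChartAt_target_eq]
    exact contDiffOn_localForm hU hh hi hlam hmu
  · have hev : DiffForm.inChart (DiffForm.fundamentalForm H) p₀
        =ᶠ[nhds y] localForm (metricInChart g p₀.1) lam mu :=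
      Filter.mem_of_superset ((isOpen_extChartAt_target p₀).mem_nhds hy) heq
    have hy1 := fst_mem_target p₀ hy
    have ht := localEnergy_nonneg hi (y := y) ⟨hy1, trivial⟩
    rw [hev.extDeriv_eq]
    refine ContinuousAlternatingMap.ext fun v => ?_
    rw [extDeriv_localForm hU hh hi hy1 (hderiv _ ht) (hmu.differentiableOn (by simp) _ ht)]
    simp

theorem exists_energyOf_eq [Nontrivial E] {b : E →L[ℝ] E →L[ℝ] ℝ} (hb : IsInner b) {t : ℝ}
    (ht : 0 ≤ t) : ∃ p : E →L[ℝ] ℝ, energyOf b p = t := by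
  obtain ⟨x, hx⟩ := exists_ne (0 : E)
  have hpos := hb.pos x hx
  -- The covector c • b x has energy ½c² b(x, x); solve for c.
  refine ⟨Real.sqrt (2 * t / b x x) • b x, ?_⟩
  simp only [energyOf, map_smul, hb.inverse_apply, smul_apply, smul_eq_mul]
  have hs := Real.mul_self_sqrt (show 0 ≤ 2 * t / b x x by positivity)
  rw [← mul_assoc (Real.sqrt _), hs]
  field_simp

/-- Dimension at least two is essential here: for n = 1 every 3-form on T*M vanishes and closedness
carries no information. -/
theorem exists_ne_zero_apply_eq_zero (hn : 2 ≤ Module.finrank ℝ E) (p : E →L[ℝ] ℝ) :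
    ∃ X : E, X ≠ 0 ∧ p X = 0 := by
  have h : LinearMap.ker (p : E →ₗ[ℝ] ℝ) ≠ ⊥ :=
    LinearMap.ker_ne_bot_of_finrank_lt (by rw [Module.finrank_self]; omega)
  obtain ⟨X, hX, hne⟩ := Submodule.exists_mem_ne_zero_of_ne_bot h
  exact ⟨X, hne, hX⟩

/-- The case t = 0 is out of reach of this pointwise argument, since dt vanishes on the zero
section. -/
theorem eq_derivWithin_of_isClosedForm [Nonempty M] (hn : 2 ≤ Module.finrank ℝ E)
    {a₁ a₂ b₁ b₂ c₁ c₂ d₁ d₂ lam mu : ℝ → ℝ}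
    (hlam : ContDiffOn ℝ ∞ lam (Ici 0)) (hmu : ContDiffOn ℝ ∞ mu (Ici 0))
    (had : ∀ t, 0 ≤ t →
      IsAdapted t (a₁ t) (a₂ t) (b₁ t) (b₂ t) (c₁ t) (c₂ t) (d₁ t) (d₂ t) (lam t) (mu t))
    (H : DiffForm.IsAlmostHermitian (natG g c₁ c₂ d₁ d₂) (natJ g a₁ a₂ b₁ b₂))
    (hclosed : DiffForm.IsClosedForm (DiffForm.fundamentalForm H)) {t : ℝ} (ht : 0 < t) :
    derivWithin lam (Ici 0) t = mu t := by
  have : Nontrivial E := Module.nontrivial_of_finrank_pos (R := ℝ) (by omega)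
  obtain ⟨x⟩ := ‹Nonempty M›
  obtain ⟨p, hp⟩ := exists_energyOf_eq (isInner_flat g x) ht.le
  set p₀ : Total E M := ⟨x, p⟩
  set y := extChartAt (model E) p₀ p₀ with hy
  have hyt : y ∈ (extChartAt (model E) p₀).target := mem_extChartAt_target p₀
  have hyeq : y = (extChartAt 𝓘(ℝ, E) x x, p) := extChartAt_self_eq p₀
  have hU : IsOpen (extChartAt 𝓘(ℝ, E) x).target := isOpen_extChartAt_target x
  have hh := contDiffOn_metricInChart g x
  have hi : ∀ z ∈ (extChartAt 𝓘(ℝ, E) x).target, IsInner (metricInChart g x z) :=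
    fun z hz => isInner_metricInChart g x hz
  have hy1 : y.1 ∈ (extChartAt 𝓘(ℝ, E) x).target := fst_mem_target p₀ hyt
  have hT : localEnergy (metricInChart g x) y = t := by
    rw [localEnergy, hyeq, metricInChart_self]
    exact hp
  have hev : DiffForm.inChart (DiffForm.fundamentalForm H) p₀
      =ᶠ[nhds y] localForm (metricInChart g x) lam mu :=
    Filter.mem_of_superset ((isOpen_extChartAt_target p₀).mem_nhds hyt)
      (fun z hz => inChart_fundamentalForm g had H p₀ hz)
  have h0 := (hclosed p₀).2 y hyt
  rw [hev.extDeriv_eq] at h0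
  have hlt : HasDerivWithinAt lam (derivWithin lam (Ici 0) t) (Ici 0) t :=
    (hlam.differentiableOn (by simp) t ht.le).hasDerivWithinAt
  obtain ⟨X, hX, hpX⟩ := exists_ne_zero_apply_eq_zero hn p
  set N := localChristoffel (metricInChart g x) y
  -- The vectors are pⱽ, Xᴴ and (g_X)ⱽ. On them dt is 2t, 0 and p(X) = 0, so only the term dt(pⱽ)
  -- dα(Xᴴ, (g_X)ⱽ) = -2t g(X, X) remains.
  have h1 := extDeriv_localForm hU hh hi hy1 (hT.symm ▸ hlt)
    (hT.symm ▸ hmu.differentiableOn (by simp) t ht.le) ![(0, p), (X, N X), (0, flat g x X)]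
  have hb := isInner_flat g x
  have hdT : ∀ w : E × (E →L[ℝ] ℝ), fderiv ℝ (localEnergy (metricInChart g x)) y w
      = p ((flat g x).inverse (w.2 - N w.1)) := by
    intro w
    rw [fderiv_localEnergy hU hh hi ⟨hy1, trivial⟩]
    have e1 : metricInChart g x y.1 = flat g x := by rw [hyeq]; exact metricInChart_self g x
    have e2 : y.2 = p := by rw [hyeq]
    rw [e1, e2]
  rw [h0, hT] at h1
  simp only [hdT, Matrix.cons_val_zero, Matrix.cons_val_one, Matrix.cons_val, map_zero, sub_zero,
    sub_self, hb.inverse_apply, hpX, zero_mul, add_zero, zero_sub, two_mul_energyOf, hp] at h1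
  have h2 : (derivWithin lam (Ici 0) t - mu t) * (2 * t * -flat g x X X) = 0 := h1.symm
  rcases mul_eq_zero.1 h2 with h3 | h3
  · linarith
  · have := mul_pos (mul_pos two_pos ht) (hb.pos X hX)
    linarith

end LocalExpressions

end Cotangent

end

/-! ### The main theorem. -/

theorem theorem6 {E : Type*} [NormedAddCommGroup E] [NormedSpace ℝ E] [FiniteDimensional ℝ E]
    {M : Type*} [TopologicalSpace M] [ChartedSpace E M] [IsManifold 𝓘(ℝ, E) ∞ M]
    [Nonempty M] (hn : 2 ≤ Module.finrank ℝ E) (g : Cotangent.Metric E M)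
    (a₁ a₂ b₁ b₂ c₁ c₂ d₁ d₂ lam mu : ℝ → ℝ)
    (ha₁ : ContDiffOn ℝ ∞ a₁ (Ici 0)) (ha₂ : ContDiffOn ℝ ∞ a₂ (Ici 0))
    (hb₁ : ContDiffOn ℝ ∞ b₁ (Ici 0)) (hb₂ : ContDiffOn ℝ ∞ b₂ (Ici 0))
    (hc₁ : ContDiffOn ℝ ∞ c₁ (Ici 0)) (hc₂ : ContDiffOn ℝ ∞ c₂ (Ici 0))
    (hd₁ : ContDiffOn ℝ ∞ d₁ (Ici 0)) (hd₂ : ContDiffOn ℝ ∞ d₂ (Ici 0))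
    (hlam : ContDiffOn ℝ ∞ lam (Ici 0)) (hmu : ContDiffOn ℝ ∞ mu (Ici 0))
    (ha₁_pos : ∀ t, 0 ≤ t → 0 < a₁ t) (ha₂_pos : ∀ t, 0 ≤ t → 0 < a₂ t)
    (hab₁_pos : ∀ t, 0 ≤ t → 0 < a₁ t + 2 * t * b₁ t)
    (hab₂_pos : ∀ t, 0 ≤ t → 0 < a₂ t + 2 * t * b₂ t)
    (hlam_pos : ∀ t, 0 ≤ t → 0 < lam t)
    (hmu_pos : ∀ t, 0 ≤ t → 0 < lam t + 2 * t * mu t)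
    (haa : ∀ t, 0 ≤ t → a₁ t * a₂ t = 1)
    (hab : ∀ t, 0 ≤ t → (a₁ t + 2 * t * b₁ t) * (a₂ t + 2 * t * b₂ t) = 1)
    (hca₁ : ∀ t, 0 ≤ t → c₁ t = lam t * a₁ t)
    (hca₂ : ∀ t, 0 ≤ t → c₂ t = lam t * a₂ t)
    (hcd₁ : ∀ t, 0 ≤ t →
      c₁ t + 2 * t * d₁ t = (lam t + 2 * t * mu t) * (a₁ t + 2 * t * b₁ t))
    (hcd₂ : ∀ t, 0 ≤ t →
      c₂ t + 2 * t * d₂ t = (lam t + 2 * t * mu t) * (a₂ t + 2 * t * b₂ t)) :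
    DiffForm.IsAlmostHermitian (Cotangent.natG g c₁ c₂ d₁ d₂) (Cotangent.natJ g a₁ a₂ b₁ b₂) ∧
      (DiffForm.IsAlmostKahler (Cotangent.natG g c₁ c₂ d₁ d₂) (Cotangent.natJ g a₁ a₂ b₁ b₂) ↔
        ∀ t, 0 ≤ t → HasDerivWithinAt lam (mu t) (Ici 0) t) := by
  have had : ∀ t, 0 ≤ t → Cotangent.IsAdapted t (a₁ t) (a₂ t) (b₁ t) (b₂ t) (c₁ t) (c₂ t)
      (d₁ t) (d₂ t) (lam t) (mu t) := fun t ht =>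
    ⟨ha₁_pos t ht, ha₂_pos t ht, hab₁_pos t ht, hab₂_pos t ht, hlam_pos t ht, hmu_pos t ht,
      haa t ht, hab t ht, hca₁ t ht, hca₂ t ht, hcd₁ t ht, hcd₂ t ht⟩
  have hH := Cotangent.isAlmostHermitian_nat g ha₁ ha₂ hb₁ hb₂ hc₁ hc₂ hd₁ hd₂ had
  refine ⟨hH, fun ⟨H, hclosed⟩ t ht => ?_, fun hderiv =>
    ⟨hH, Cotangent.isClosedForm_fundamentalForm g hlam hmu had hH hderiv⟩⟩
  have hpos : EqOn (derivWithin lam (Ici 0)) mu (Ioi 0) := fun s hs =>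
    Cotangent.eq_derivWithin_of_isClosedForm g hn hlam hmu had H hclosed hs
  -- Both functions are continuous on [0, ∞), and (0, ∞) is dense in it.
  have hall : EqOn (derivWithin lam (Ici 0)) mu (Ici 0) :=
    hpos.of_subset_closure (hlam.continuousOn_derivWithin (uniqueDiffOn_Ici 0) (by simp))
      hmu.continuousOn Ioi_subset_Ici_self (by rw [closure_Ioi])
  rw [← hall ht]
  exact (hlam.differentiableOn (by simp) t ht).hasDerivWithinAt
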